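/- Let $d\ge 1$, let $\mathcal H_s=\ell^2(\{0,\dots,d-1\})\simeq\mathbb C^d$ with canonical basis $e_0,\dots,e_{d-1}$, and let $\mathcal H_r=\ell^2(\mathbb Z)$ with canonical basis $(\Psi_j)_{j\in\mathbb Z}$. Let $a^*,a$ and $b^*,b$ be the fermionic creation and annihilation operators on the antisymmetric Fock spaces $\mathcal F_-(\mathcal H_s)$ and $\mathcal F_-(\mathcal H_r)$, let $\mathcal A,\mathcal B$ be the $C^*$-algebras they generate, and write $a_j=a(e_j)$, $b_j=b(\Psi_j)$. Let $W$ be an arbitrary unitary operator on $\mathcal H_s$, let $S$ be the shift $S\Psi_j=\Psi_{j-1}$ on $\mathcal H_r$, let $\alpha\in\mathbb R$, and on $\mathcal F_-(\mathcal H_r)\otimes\mathcal F_-(\mathcal H_s)$ put $$U=(\Gamma(S)\otimes\Gamma(W))\,\exp[-i\alpha(b_0^*\otimes a_0+b_0\otimes a_0^*)],\qquad \tau^t(X)=U^{*t}XU^t ,$$ where $\Gamma$ denotes second quantization. Let $0\le\sigma\le 1$ and let $\omega$ be the gauge-invariant quasi-free state on $\mathcal B$ with density $\Sigma=\sigma\mathbb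 I$, that is, $$\omega(b^*(\phi_m)\cdots b^*(\phi_1)b(\psi_1)\cdots b(\psi_n))=\delta_{nm}\det\big(\langle\psi_j|\Sigma\phi_k\rangle\big)_{j,k}$$ for all $m,n$ and all $\phi_i,\psi_i\in\mathcal H_r$. Let $\rho$ be a density matrix (a positive operator of trace one) on $\mathcal F_-(\mathcal H_s)$, and for $t\in\mathbb N=\{0,1,2,\dots\}$ let $\rho_t(A)=(\omega\otimes\rho)(\tau^t(\mathbb I\otimes A))$, $A\in\mathcal A$, where $\rho(A)=\operatorname{tr}(\rho A)$. The one- and two-body reduced density matrices at time $t$ are the operators $\rho^{(1)}_t$ on $\mathcal H_s$ and $\rho_t^{(2)}$ on $\mathcal H_s\wedge\mathcal H_s$ with $$\langle e_j|\rho_t^{(1)}e_k\rangle=\rho_t(a_k^*a_j),\qquad \langle e_{j_1}\wedge e_{j_2}|\rho_t^{(2)}\,e_{k_1}\wedge e_{k_2}\rangle=\rho_t(a_{k_1}^*a_{k_2}^*a_{j_2}a_{j_1}),$$ where $u\wedge v=\frac1{\sqrt2}(u\otimes v-v\otimes u)$; $\rho^{(2)}$ denotes the two-body reduced density matrix defined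 in the same way from $\rho$. Let $P_A$ be the orthogonal projection of $\mathcal H_s\otimes\mathcal H_s$ onto $\mathcal H_s\wedge\mathcal H_s$, let $P^\perp=\mathbb I-|e_0\rangle\langle e_0|$, and $$\mathbb M=W\big(\mathbb I+(\cos\alpha-1)|e_0\rangle\langle e_0|\big),\qquad \mathbb B=\sigma\sin^2(\alpha)\,W|e_0\rangle\langle e_0|W^*,\qquad \mathbb K=WP^\perp .$$ Then $\rho_0^{(2)}=\rho^{(2)}$, and for all $t\ge 0$ $$\rho^{(2)}_{t+1}=P_A\mathbb M^{\otimes2}P_A\,\rho_t^{(2)}\,P_A{\mathbb M^*}^{\otimes2}P_A+2P_A\,\mathbb B\otimes(\mathbb K\rho_t^{(1)}\mathbb K^*)\,P_A ,$$ and for all $t\ge1$ $$\rho^{(2)}_t=(P_A\mathbb M^{\otimes2}P_A)^t\rho_0^{(2)}(P_A{\mathbb M^*}^{\otimes2}P_A)^t+\sum_{r=0}^{t-1}2(P_A\mathbb M^{\otimes2}P_A)^r\,P_A\,\mathbb B\otimes(\mathbb K\rho^{(1)}_{t-1-r}\mathbb K^*)\,P_A\,(P_A{\mathbb M^*}^{\otimes2}P_A)^r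 .$$ -/

import Mathlib

open scoped ComplexOrder Kronecker InnerProductSpace

noncomputable section

namespace FermionWalk

/-! ### Antisymmetric Fock spaces in the occupation-number representation -/

/-- The one-particle space `ℓ²(ι)`. -/
abbrev OneParticle (ι : Type) : Type := lp (fun _ : ι => ℂ) 2

/-- The antisymmetric Fock space over `ℓ²(ι)`, `ι` linearly ordered, written in its canonical
orthonormal basis `e_{i₁} ∧ ⋯ ∧ e_{i_p}` with `i₁ < ⋯ < i_p`, `p ≥ 0`; this basis is indexed by the
finite subsets `{i₁, …, i_p}` of `ι`. -/
abbrev Fock (ι : Type) : Type := lp (fun _ : Finset ι => ℂ) 2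

/-- The basis vector `e_{i₁} ∧ ⋯ ∧ e_{i_p}` for `I = {i₁ < ⋯ < i_p}`. -/
def basisVec {ι : Type} [LinearOrder ι] (I : Finset ι) : Fock ι :=
  lp.single 2 I (1 : ℂ)

/-- The vacuum vector `Ω`. -/
def vacuum (ι : Type) [LinearOrder ι] : Fock ι := basisVec ∅

lemma weighted_sum_le {X : Type} (w : X → ℂ) (e : X → X) (hw : ∀ x, ‖w x‖ ≤ 1)
    (he : ∀ x y, w x ≠ 0 → w y ≠ 0 → e x = e y → x = y)
    (f : lp (fun _ : X => ℂ) 2) (s : Finset X) :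
    ∑ x ∈ s, ‖w x * f (e x)‖ ^ (2 : ENNReal).toReal ≤ ‖f‖ ^ (2 : ENNReal).toReal := by
  classical
  have h2 : (0 : ℝ) < (2 : ENNReal).toReal := by norm_num
  have hinj : Set.InjOn e (s.filter fun x => w x ≠ 0 : Finset X) := by
    intro x hx y hy hxy
    simp only [Finset.coe_filter, Set.mem_ofPred_eq] at hx hy
    exact he x y hx.2 hy.2 hxy
  calc ∑ x ∈ s, ‖w x * f (e x)‖ ^ (2 : ENNReal).toReal
      = ∑ x ∈ s.filter (fun x => w x ≠ 0), ‖w x * f (e x)‖ ^ (2 : ENNReal).toReal := by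
        rw [Finset.sum_filter_of_ne]
        intro x _ hx h0
        apply hx
        rw [h0, zero_mul, norm_zero, Real.zero_rpow h2.ne']
    _ ≤ ∑ x ∈ s.filter (fun x => w x ≠ 0), ‖f (e x)‖ ^ (2 : ENNReal).toReal := by
        refine Finset.sum_le_sum fun x _ => ?_
        refine Real.rpow_le_rpow (norm_nonneg _) ?_ h2.le
        rw [norm_mul]
        exact mul_le_of_le_one_left (norm_nonneg _) (hw x)
    _ = ∑ y ∈ (s.filter (fun x => w x ≠ 0)).image e, ‖f y‖ ^ (2 : ENNReal).toReal :=
        (Finset.sum_image (f := fun y => ‖f y‖ ^ (2 : ENNReal).toReal) hinj).symm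
    _ ≤ ‖f‖ ^ (2 : ENNReal).toReal := lp.sum_rpow_le_norm_rpow h2 f _

/-- The bounded operator `(T f)(x) = w(x) f(e(x))` on `ℓ²(X)`, for weights `|w| ≤ 1` and a map `e`
that is injective where `w` does not vanish. -/
def weightedComp {X : Type} (w : X → ℂ) (e : X → X) (hw : ∀ x, ‖w x‖ ≤ 1)
    (he : ∀ x y, w x ≠ 0 → w y ≠ 0 → e x = e y → x = y) :
    lp (fun _ : X => ℂ) 2 →L[ℂ] lp (fun _ : X => ℂ) 2 :=
  LinearMap.mkContinuous
    { toFun := fun f => ⟨fun x => w x * f (e x), memℓp_gen' (weighted_sum_le w e hw he f)⟩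
      map_add' := fun f g => by
        ext x
        exact mul_add _ _ _
      map_smul' := fun c f => by
        ext x
        exact mul_left_comm _ _ _ }
    1 fun f => by
      rw [one_mul]
      exact lp.norm_le_of_forall_sum_le (by norm_num) (norm_nonneg f) (weighted_sum_le w e hw he f)

lemma weightedComp_apply {X : Type} (w : X → ℂ) (e : X → X) (hw : ∀ x, ‖w x‖ ≤ 1)
    (he : ∀ x y, w x ≠ 0 → w y ≠ 0 → e x = e y → x = y) (f : lp (fun _ : X => ℂ) 2) (x : X) :
    weightedComp w e hw he f x = w x * f (e x) := rfl

/-- The sign `(-1)^{#{i ∈ I : i < j}}`, so that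
`e_j ∧ (e_{i₁} ∧ ⋯ ∧ e_{i_p}) = sgn(j, I) · (ordered wedge over I ∪ {j})` when `j ∉ I`. -/
def sgn {ι : Type} [LinearOrder ι] (j : ι) (I : Finset ι) : ℂ :=
  (-1) ^ (I.filter fun i => i < j).card

lemma norm_sgn {ι : Type} [LinearOrder ι] (j : ι) (I : Finset ι) : ‖sgn j I‖ = 1 := by
  simp [sgn]

/-- The creation operator `c*(e_j)`, `c*(e_j) (e_{i₁} ∧ ⋯ ∧ e_{i_p}) = e_j ∧ e_{i₁} ∧ ⋯ ∧ e_{i_p}`;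
on coefficients, `(c*(e_j) ψ)(I) = sgn(j, I) ψ(I \ {j})` if `j ∈ I`, and `0` otherwise. -/
def createAt {ι : Type} [LinearOrder ι] (j : ι) : Fock ι →L[ℂ] Fock ι :=
  weightedComp (fun I => if j ∈ I then sgn j I else 0) (fun I => I.erase j)
    (fun I => by
      split_ifs
      · exact (norm_sgn j I).le
      · simp)
    (fun I J hI hJ h => by
      have hI' : j ∈ I := by by_contra h'; simp [h'] at hI
      have hJ' : j ∈ J := by by_contra h'; simp [h'] at hJ
      rw [← Finset.insert_erase hI', h, Finset.insert_erase hJ'])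

/-- The creation operator `c*(φ) = ∑_j φ_j c*(e_j)`, `φ ∈ ℓ²(ι)`; the series converges
unconditionally in operator norm, because `‖∑_{j ∈ F} φ_j c*(e_j)‖² = ∑_{j ∈ F} |φ_j|²`
for every finite set `F`. -/
def create {ι : Type} [LinearOrder ι] (φ : OneParticle ι) : Fock ι →L[ℂ] Fock ι :=
  ∑' j, φ j • createAt j

/-- The annihilation operator `c(φ)`, the adjoint of `c*(φ)`. -/
def annih {ι : Type} [LinearOrder ι] (φ : OneParticle ι) : Fock ι →L[ℂ] Fock ι :=
  star (create φ)

/-- The canonical basis vector `e_j` of `ℓ²(ι)`. -/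
def basisOne {ι : Type} [LinearOrder ι] (j : ι) : OneParticle ι := lp.single 2 j (1 : ℂ)

lemma create_basisOne {ι : Type} [LinearOrder ι] (j : ι) :
    create (basisOne j) = createAt j := by
  rw [create, tsum_eq_single j]
  · simp [basisOne]
  · intro i hi
    simp [basisOne, hi]

/-! ### The reservoir -/

/-- The free evolution `U_r = Γ(S)` of the reservoir, the second quantization of the shift
`S Ψ_j = Ψ_{j-1}` on `ℓ²(ℤ)`. As `S` preserves the order of the basis,
`Γ(S)` maps `Ψ_{i₁} ∧ ⋯ ∧ Ψ_{i_p}` to `Ψ_{i₁-1} ∧ ⋯ ∧ Ψ_{i_p-1}`; on coefficients,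
`(Γ(S) ψ)(I) = ψ(I + 1)`. -/
def shiftFock : Fock ℤ →L[ℂ] Fock ℤ :=
  weightedComp (fun _ => 1) (fun I => I.map (Equiv.addRight (1 : ℤ)).toEmbedding)
    (fun _ => by simp) (fun _ _ _ _ h => Finset.map_injective _ h)

/-- The C*-algebra `ℬ` generated by the creation and annihilation operators of the reservoir. -/
def resAlg : StarSubalgebra ℂ (Fock ℤ →L[ℂ] Fock ℤ) :=
  (StarAlgebra.adjoin ℂ (Set.range (create (ι := ℤ)))).topologicalClosure

/-- `b*(φ)` as an element of `ℬ`. -/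
def resCreate (φ : OneParticle ℤ) : resAlg :=
  ⟨create φ, StarSubalgebra.le_topologicalClosure _
    (StarAlgebra.subset_adjoin ℂ _ (Set.mem_range_self φ))⟩

/-- `b(φ)` as an element of `ℬ`. -/
def resAnnih (φ : OneParticle ℤ) : resAlg := star (resCreate φ)

/-- A state on a unital C*-algebra: a positive normalized linear functional. -/
structure IsState {A : Type} [Ring A] [StarRing A] [Algebra ℂ A] (ω : A →ₗ[ℂ] ℂ) : Prop where
  map_one : ω 1 = 1
  nonneg : ∀ x, 0 ≤ ω (star x * x)

/-- `ω` is a gauge-invariant quasi-free state on `ℬ` with density `Σ = T`: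
`ω(b*(φ_m) ⋯ b*(φ_1) b(ψ_1) ⋯ b(ψ_n)) = δ_{nm} det ⟨ψ_j, Σ φ_k⟩`. -/
structure IsQuasiFree (ω : resAlg →ₗ[ℂ] ℂ) (T : OneParticle ℤ →L[ℂ] OneParticle ℤ) : Prop where
  isState : IsState ω
  eq_det : ∀ (n : ℕ) (φ ψ : Fin n → OneParticle ℤ),
    ω ((List.ofFn fun i => resCreate (φ i)).reverse.prod *
        (List.ofFn fun i => resAnnih (ψ i)).prod) =
      (Matrix.of fun j k => ⟪ψ j, T (φ k)⟫_ℂ).det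
  eq_zero : ∀ (m n : ℕ) (φ : Fin m → OneParticle ℤ) (ψ : Fin n → OneParticle ℤ), m ≠ n →
    ω ((List.ofFn fun i => resCreate (φ i)).reverse.prod *
        (List.ofFn fun i => resAnnih (ψ i)).prod) = 0

/-! ### The sample -/

/-- The free evolution `U_s = Γ(W)` of the sample, the second quantization of the operator with
matrix `W` on `ℓ²({0, …, d-1})`:
`Γ(W) (e_{i₁} ∧ ⋯ ∧ e_{i_p}) = W e_{i₁} ∧ ⋯ ∧ W e_{i_p} = a*(W e_{i₁}) ⋯ a*(W e_{i_p}) Ω`. -/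
def secondQuant {d : ℕ} (W : Matrix (Fin d) (Fin d) ℂ) : Fock (Fin d) →L[ℂ] Fock (Fin d) :=
  ∑ I : Finset (Fin d), (innerSL ℂ (basisVec I)).smulRight
    (((I.sort (· ≤ ·)).map fun i => create ⟨fun j => W j i, Memℓp.all _⟩).prod (vacuum (Fin d)))

/-- The trace of an operator on the finite-dimensional space `𝓕₋(ℓ²({0, …, d-1}))`. -/
def fockTrace {d : ℕ} (T : Fock (Fin d) →L[ℂ] Fock (Fin d)) : ℂ :=
  ∑ I : Finset (Fin d), ⟪basisVec I, T (basisVec I)⟫_ℂ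

/-- Density matrices: positive operators of trace one. -/
structure IsDensityMatrix {d : ℕ} (ρ : Fock (Fin d) →L[ℂ] Fock (Fin d)) : Prop where
  isPositive : ρ.IsPositive
  trace_eq_one : fockTrace ρ = 1

/-! ### The composite system -/

/-- The Fock space `𝓕 = 𝓕₋(ℋ_r) ⊗ 𝓕₋(ℋ_s)`. As `𝓕₋(ℋ_s)` has the finite orthonormal basis
`(basisVec I)_I`, every vector is uniquely `∑_I ψ_I ⊗ basisVec I`, of squared norm
`∑_I ‖ψ_I‖²`; it is represented by the family `(ψ_I)_I`. -/
abbrev Joint (d : ℕ) : Type := PiLp 2 fun _ : Finset (Fin d) => Fock ℤ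

/-- The map `ψ ↦ ψ_I`, that is `1 ⊗ ⟨basisVec I|`. -/
def slot {d : ℕ} (I : Finset (Fin d)) : Joint d →L[ℂ] Fock ℤ :=
  PiLp.proj 2 (fun _ : Finset (Fin d) => Fock ℤ) I

/-- The `(I, J)` block `(1 ⊗ ⟨basisVec I|) X (1 ⊗ |basisVec J⟩)` of an operator on `𝓕`. -/
def block {d : ℕ} (I J : Finset (Fin d)) (X : Joint d →L[ℂ] Joint d) : Fock ℤ →L[ℂ] Fock ℤ :=
  slot I ∘L X ∘L (slot J).adjoint

/-- The operator `A ⊗ C` on `𝓕`, whose `(I, J)` block is `⟨basisVec I, C basisVec J⟩ A`. -/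
def tens {d : ℕ} (A : Fock ℤ →L[ℂ] Fock ℤ) (C : Fock (Fin d) →L[ℂ] Fock (Fin d)) :
    Joint d →L[ℂ] Joint d :=
  ∑ I, ∑ J, ⟪basisVec I, C (basisVec J)⟫_ℂ • ((slot I).adjoint ∘L A ∘L slot J)


lemma slot_comp_adjoint {d : ℕ} (I J : Finset (Fin d)) :
    slot I ∘L (slot J).adjoint = if I = J then 1 else 0 := by
  have key : ∀ (ψ : Fock ℤ), (slot J).adjoint ψ = PiLp.single 2 J ψ := by
    intro ψ
    refine ext_inner_right ℂ fun v => ?_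
    rw [ContinuousLinearMap.adjoint_inner_left, PiLp.inner_apply, Finset.sum_eq_single J]
    · simp [slot]
    · intro K _ hK
      rw [PiLp.single_eq_of_ne (p := 2) hK, inner_zero_left]
    · simp
  ext1 ψ
  rw [ContinuousLinearMap.comp_apply, key]
  by_cases h : I = J
  · subst h; simp [slot]
  · simp [slot, h]

lemma sum_adjoint_comp_slot (d : ℕ) :
    ∑ I : Finset (Fin d), (slot I).adjoint ∘L slot I = 1 := by
  refine ContinuousLinearMap.ext fun ψ => ext_inner_right ℂ fun v => ?_
  simp [sum_inner, ContinuousLinearMap.adjoint_inner_left,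
    PiLp.inner_apply, slot]

lemma block_mul {d : ℕ} (I J : Finset (Fin d)) (X Y : Joint d →L[ℂ] Joint d) :
    block I J (X * Y) = ∑ K, block I K X * block K J Y := by
  calc block I J (X * Y)
      = slot I ∘L X ∘L (1 : Joint d →L[ℂ] Joint d) ∘L Y ∘L (slot J).adjoint := rfl
    _ = ∑ K, block I K X * block K J Y := by
        rw [← sum_adjoint_comp_slot d]
        ext1 ψ
        simp [block, map_sum]

lemma block_star {d : ℕ} (I J : Finset (Fin d)) (X : Joint d →L[ℂ] Joint d) :
    block I J (star X) = star (block J I X) := by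
  simp only [block, ContinuousLinearMap.star_eq_adjoint, ContinuousLinearMap.adjoint_comp,
    ContinuousLinearMap.adjoint_adjoint]
  rfl

lemma block_add {d : ℕ} (I J : Finset (Fin d)) (X Y : Joint d →L[ℂ] Joint d) :
    block I J (X + Y) = block I J X + block I J Y := by
  ext1 ψ
  simp [block]

lemma block_smul {d : ℕ} (I J : Finset (Fin d)) (c : ℂ) (X : Joint d →L[ℂ] Joint d) :
    block I J (c • X) = c • block I J X := by
  ext1 ψ
  simp [block]

lemma block_one {d : ℕ} (I J : Finset (Fin d)) :
    block I J (1 : Joint d →L[ℂ] Joint d) = if I = J then 1 else 0 :=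
  slot_comp_adjoint I J

lemma block_tens {d : ℕ} (I J : Finset (Fin d)) (A : Fock ℤ →L[ℂ] Fock ℤ)
    (C : Fock (Fin d) →L[ℂ] Fock (Fin d)) :
    block I J (tens A C) = ⟪basisVec I, C (basisVec J)⟫_ℂ • A := by
  have h : ∀ (K L : Finset (Fin d)) (ψ : Fock ℤ),
      slot K ((slot L).adjoint ψ) = if K = L then ψ else 0 := by
    intro K L ψ
    have := congrArg (fun T : Fock ℤ →L[ℂ] Fock ℤ => T ψ) (slot_comp_adjoint K L)
    simp only [ContinuousLinearMap.comp_apply] at this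
    rw [this]
    split_ifs <;> simp
  ext1 ψ
  simp only [block, tens, ContinuousLinearMap.comp_apply, sum_apply,
    smul_apply, map_sum, map_smul, h]
  rw [Finset.sum_eq_single I, Finset.sum_eq_single J]
  · simp
  · intro K _ hK
    simp [hK]
  · simp
  · intro K _ hK
    simp [hK.symm]
  · simp

lemma continuous_block {d : ℕ} (I J : Finset (Fin d)) :
    Continuous (block I J : (Joint d →L[ℂ] Joint d) → _) := by
  unfold block
  fun_prop

/-- The C*-algebra `ℬ ⊗ 𝒜` on `𝓕`. As `𝒜` is the full matrix algebra over the basis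
`(basisVec I)_I`, it consists of the operators all of whose blocks lie in `ℬ`. -/
def jointAlg (d : ℕ) : StarSubalgebra ℂ (Joint d →L[ℂ] Joint d) where
  carrier := {X | ∀ I J, block I J X ∈ resAlg}
  mul_mem' := fun {X Y} hX hY I J => by
    rw [block_mul]
    exact sum_mem fun K _ => mul_mem (hX I K) (hY K J)
  add_mem' := fun {X Y} hX hY I J => by
    rw [block_add]
    exact add_mem (hX I J) (hY I J)
  algebraMap_mem' := fun r I J => by
    rw [Algebra.algebraMap_eq_smul_one, block_smul, block_one]
    refine resAlg.smul_mem ?_ r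
    split_ifs
    · exact one_mem _
    · exact zero_mem _
  star_mem' := fun {X} hX I J => by
    rw [block_star]
    exact star_mem (hX J I)

lemma isClosed_jointAlg (d : ℕ) : IsClosed (jointAlg d : Set (Joint d →L[ℂ] Joint d)) := by
  have : (jointAlg d : Set (Joint d →L[ℂ] Joint d)) =
      ⋂ I, ⋂ J, block I J ⁻¹' (resAlg : Set (Fock ℤ →L[ℂ] Fock ℤ)) := by
    ext X
    simp only [Set.mem_iInter, Set.mem_preimage]
    rfl
  rw [this]
  exact isClosed_iInter fun I => isClosed_iInter fun J =>
    (StarSubalgebra.isClosed_topologicalClosure _).preimage (continuous_block I J)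

lemma tens_mem {d : ℕ} {A : Fock ℤ →L[ℂ] Fock ℤ} (hA : A ∈ resAlg)
    (C : Fock (Fin d) →L[ℂ] Fock (Fin d)) : tens A C ∈ jointAlg d := fun I J => by
  rw [block_tens]
  exact resAlg.smul_mem hA _

/-! ### The dynamics -/

/-- The coupling `K = exp(-iα (b₀* ⊗ a₀ + b₀ ⊗ a₀*))`. -/
def coupling (d : ℕ) [NeZero d] (α : ℝ) : Joint d →L[ℂ] Joint d :=
  NormedSpace.exp ((-(Complex.I * α)) •
    (tens (create (basisOne 0)) (annih (basisOne 0)) +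
      tens (annih (basisOne 0)) (create (basisOne 0))))

/-- The one time step evolution `U = (U_r ⊗ U_s) K`. -/
def stepOp {d : ℕ} [NeZero d] (W : Matrix (Fin d) (Fin d) ℂ) (α : ℝ) : Joint d →L[ℂ] Joint d :=
  tens shiftFock (secondQuant W) * coupling d α

lemma coupling_mem (d : ℕ) [NeZero d] (α : ℝ) : coupling d α ∈ jointAlg d := by
  have h1 : create (basisOne (0 : ℤ)) ∈ resAlg := (resCreate (basisOne 0)).2
  have h2 : annih (basisOne (0 : ℤ)) ∈ resAlg := (resAnnih (basisOne 0)).2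
  exact NormedSpace.exp_mem (R := ℂ) (isClosed_jointAlg d)
    ((jointAlg d).smul_mem (add_mem (tens_mem h1 _) (tens_mem h2 _)) _)


lemma createAt_mul_shiftFock (j : ℤ) :
    createAt j * shiftFock = shiftFock * createAt (j + 1) := by
  ext ψ I
  have hs : sgn (j + 1) (I.map (Equiv.addRight (1 : ℤ)).toEmbedding) = sgn j I := by
    simp [sgn, Finset.filter_map, Function.comp_def]
  have he : (I.map (Equiv.addRight (1 : ℤ)).toEmbedding).erase (j + 1) =
      (I.erase j).map (Equiv.addRight (1 : ℤ)).toEmbedding := by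
    ext x
    simp
  have hm : j + 1 ∈ I.map (Equiv.addRight (1 : ℤ)).toEmbedding ↔ j ∈ I := by simp
  change (if j ∈ I then sgn j I else 0) *
      (1 * ψ ((I.erase j).map (Equiv.addRight (1 : ℤ)).toEmbedding)) =
    1 * ((if j + 1 ∈ I.map (Equiv.addRight (1 : ℤ)).toEmbedding then
        sgn (j + 1) (I.map (Equiv.addRight (1 : ℤ)).toEmbedding) else 0) *
      ψ ((I.map (Equiv.addRight (1 : ℤ)).toEmbedding).erase (j + 1)))
  rw [hs, he, one_mul, one_mul]
  simp only [hm]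

/-- The shift `I ↦ I + 1` on finite subsets of `ℤ`. -/
def shiftFinset : Finset ℤ ≃ Finset ℤ := (Equiv.addRight (1 : ℤ)).finsetCongr

lemma shiftFock_apply (ψ : Fock ℤ) (I : Finset ℤ) : shiftFock ψ I = ψ (shiftFinset I) :=
  one_mul _

lemma inner_shiftFock (ψ χ : Fock ℤ) : ⟪shiftFock ψ, shiftFock χ⟫_ℂ = ⟪ψ, χ⟫_ℂ := by
  rw [lp.inner_eq_tsum, lp.inner_eq_tsum]
  simp only [shiftFock_apply]
  exact shiftFinset.tsum_eq fun I => ⟪ψ I, χ I⟫_ℂ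

lemma shiftFock_surjective : Function.Surjective shiftFock := fun ψ =>
  ⟨weightedComp (fun _ => 1) shiftFinset.symm (fun _ => by simp)
    (fun _ _ _ _ h => shiftFinset.symm.injective h) ψ, by
      ext I
      rw [shiftFock_apply, weightedComp_apply, Equiv.symm_apply_apply, one_mul]⟩

lemma star_shiftFock_mul : star shiftFock * shiftFock = 1 := by
  refine ContinuousLinearMap.ext fun ψ => ext_inner_right ℂ fun χ => ?_
  exact (ContinuousLinearMap.adjoint_inner_left shiftFock χ (shiftFock ψ)).trans
    (inner_shiftFock ψ χ)

lemma shiftFock_mul_star : shiftFock * star shiftFock = 1 := by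
  ext1 ψ
  obtain ⟨χ, rfl⟩ := shiftFock_surjective ψ
  have := congrArg (fun T : Fock ℤ →L[ℂ] Fock ℤ => shiftFock (T χ)) star_shiftFock_mul
  exact this

lemma shift_create (φ : OneParticle ℤ) :
    ∃ φ' : OneParticle ℤ, star shiftFock * create φ * shiftFock = create φ' := by
  have hinj : Function.Injective fun j : ℤ => j - 1 := sub_left_injective
  refine ⟨weightedComp (fun _ => 1) (fun j : ℤ => j - 1) (fun _ => by simp)
    (fun _ _ _ _ h => hinj h) φ, ?_⟩
  have hl : Function.LeftInverse (fun X => shiftFock * X * star shiftFock)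
      (fun X => star shiftFock * X * shiftFock) := fun X => by
    calc shiftFock * (star shiftFock * X * shiftFock) * star shiftFock
        = (shiftFock * star shiftFock) * X * (shiftFock * star shiftFock) := by
          simp only [mul_assoc]
      _ = X := by rw [shiftFock_mul_star, one_mul, mul_one]
  let f : (Fock ℤ →L[ℂ] Fock ℤ) →+ (Fock ℤ →L[ℂ] Fock ℤ) :=
    (AddMonoidHom.mulRight shiftFock).comp (AddMonoidHom.mulLeft (star shiftFock))
  have h1 : f (create φ) = ∑' j, f (φ j • createAt j) := by
    refine Function.LeftInverse.map_tsum (g := f) _ ?_ ?_ hl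
    · exact (continuous_const.mul continuous_id).mul continuous_const
    · exact (continuous_const.mul continuous_id).mul continuous_const
  have h2 : ∀ j, f (φ j • createAt j) = φ j • createAt (j + 1) := fun j => by
    calc f (φ j • createAt j) = star shiftFock * (φ j • createAt j) * shiftFock := rfl
      _ = φ j • createAt (j + 1) := by
        rw [mul_smul_comm, smul_mul_assoc, mul_assoc, createAt_mul_shiftFock, ← mul_assoc,
          star_shiftFock_mul, one_mul]
  have h3 : create (weightedComp (fun _ => 1) (fun j : ℤ => j - 1) (fun _ => by simp)
      (fun _ _ _ _ h => hinj h) φ) = ∑' j, φ j • createAt (j + 1) := by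
    rw [create, ← (Equiv.addRight (1 : ℤ)).tsum_eq]
    refine tsum_congr fun j => ?_
    rw [weightedComp_apply]
    simp
  rw [h3, ← tsum_congr h2, ← h1]
  rfl

lemma shift_conj_mem {X : Fock ℤ →L[ℂ] Fock ℤ} (hX : X ∈ resAlg) :
    star shiftFock * X * shiftFock ∈ resAlg := by
  let u : unitary (Fock ℤ →L[ℂ] Fock ℤ) := ⟨shiftFock, star_shiftFock_mul, shiftFock_mul_star⟩
  let f : (Fock ℤ →L[ℂ] Fock ℤ) →⋆ₐ[ℂ] (Fock ℤ →L[ℂ] Fock ℤ) :=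
    ((Unitary.conjStarAlgAut ℂ (Fock ℤ →L[ℂ] Fock ℤ) (star u) :
      (Fock ℤ →L[ℂ] Fock ℤ) ≃⋆ₐ[ℂ] (Fock ℤ →L[ℂ] Fock ℤ)) : _ →⋆ₐ[ℂ] _)
  have hf : ∀ Y, f Y = star shiftFock * Y * shiftFock := fun Y =>
    Unitary.conjStarAlgAut_star_apply (S := ℂ) u Y
  have hc : Continuous f := by
    rw [show (f : _ → _) = fun Y => star shiftFock * Y * shiftFock from funext hf]
    exact (continuous_const.mul continuous_id).mul continuous_const
  have hle : resAlg ≤ resAlg.comap f := by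
    refine StarSubalgebra.topologicalClosure_minimal (StarAlgebra.adjoin_le ?_)
      ((StarSubalgebra.isClosed_topologicalClosure _).preimage hc)
    rintro _ ⟨φ, rfl⟩
    obtain ⟨φ', h⟩ := shift_create φ
    change f (create φ) ∈ resAlg
    rw [hf, h]
    exact (resCreate φ').2
  have := hle hX
  rw [← hf]
  exact this

lemma step_mem {d : ℕ} [NeZero d] (W : Matrix (Fin d) (Fin d) ℂ) (α : ℝ)
    {X : Joint d →L[ℂ] Joint d} (hX : X ∈ jointAlg d) :
    star (stepOp W α) * X * stepOp W α ∈ jointAlg d := by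
  have hF : star (tens shiftFock (secondQuant W)) * X * tens shiftFock (secondQuant W) ∈
      jointAlg d := by
    intro I J
    rw [block_mul]
    refine sum_mem fun K _ => ?_
    rw [block_mul, Finset.sum_mul]
    refine sum_mem fun L _ => ?_
    rw [block_star, block_tens, block_tens, star_smul, mul_smul_comm, smul_mul_assoc,
      smul_mul_assoc]
    exact resAlg.smul_mem (resAlg.smul_mem (shift_conj_mem (hX L K)) _) _
  have hK := coupling_mem d α
  have : star (stepOp W α) * X * stepOp W α = star (coupling d α) *
      (star (tens shiftFock (secondQuant W)) * X * tens shiftFock (secondQuant W)) *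
      coupling d α := by
    rw [stepOp, star_mul]
    simp only [mul_assoc]
  rw [this]
  exact mul_mem (mul_mem (star_mem hK) hF) hK

lemma evolve_mem {d : ℕ} [NeZero d] (W : Matrix (Fin d) (Fin d) ℂ) (α : ℝ) (t : ℕ)
    {X : Joint d →L[ℂ] Joint d} (hX : X ∈ jointAlg d) :
    star (stepOp W α ^ t) * X * stepOp W α ^ t ∈ jointAlg d := by
  induction t with
  | zero => simpa using hX
  | succ t ih =>
    have := step_mem W α ih
    rw [pow_succ, star_mul]
    simpa only [mul_assoc] using this

/-- The evolution `τ^t(X) = U*^t X U^t` on `ℬ ⊗ 𝒜`. -/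
def evolve {d : ℕ} [NeZero d] (W : Matrix (Fin d) (Fin d) ℂ) (α : ℝ) (t : ℕ) (X : jointAlg d) :
    jointAlg d :=
  ⟨star (stepOp W α ^ t) * X * stepOp W α ^ t, evolve_mem W α t X.2⟩

/-- The observable `1 ⊗ A`. -/
def sampleObs {d : ℕ} (A : Fock (Fin d) →L[ℂ] Fock (Fin d)) : jointAlg d :=
  ⟨tens 1 A, tens_mem (one_mem _) A⟩

/-- The product functional `ω ⊗ ρ` on `ℬ ⊗ 𝒜`, `(ω ⊗ ρ)(B ⊗ A) = ω(B) tr(ρ A)`. -/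
def prodState {d : ℕ} (ω : resAlg →ₗ[ℂ] ℂ) (ρ : Fock (Fin d) →L[ℂ] Fock (Fin d))
    (X : jointAlg d) : ℂ :=
  ∑ I, ∑ J, ⟪basisVec J, ρ (basisVec I)⟫_ℂ * ω ⟨block I J X, X.2 I J⟩

/-- The state of the sample at time `t`, `ρ_t(A) = (ω ⊗ ρ)(τ^t(1 ⊗ A))`. -/
def sampleState {d : ℕ} [NeZero d] (ω : resAlg →ₗ[ℂ] ℂ) (ρ : Fock (Fin d) →L[ℂ] Fock (Fin d))
    (W : Matrix (Fin d) (Fin d) ℂ) (α : ℝ) (t : ℕ) (A : Fock (Fin d) →L[ℂ] Fock (Fin d)) : ℂ :=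
  prodState ω ρ (evolve W α t (sampleObs A))

/-! ### Reduced density matrices -/

/-- The one-body reduced density matrix of a functional `f` on the observables of the sample,
`⟨e_j | ρ⁽¹⁾ e_k⟩ = f(a_k* a_j)`. -/
def oneBody {d : ℕ} (f : (Fock (Fin d) →L[ℂ] Fock (Fin d)) → ℂ) : Matrix (Fin d) (Fin d) ℂ :=
  Matrix.of fun j k => f (create (basisOne k) * annih (basisOne j))

/-- The vector `e_{j₁} ∧ e_{j₂} = (e_{j₁} ⊗ e_{j₂} - e_{j₂} ⊗ e_{j₁}) / √2` of `ℋ_s ⊗ ℋ_s`. -/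
def wedge {d : ℕ} (j : Fin d × Fin d) : Fin d × Fin d → ℂ :=
  ((Real.sqrt 2 : ℝ) : ℂ)⁻¹ • (Pi.single j 1 - Pi.single j.swap 1)

/-- The two-body reduced density matrix of a functional `f`: the operator on
`ℋ_s ∧ ℋ_s ⊆ ℋ_s ⊗ ℋ_s` whose matrix elements in the orthonormal basis
`(e_{j₁} ∧ e_{j₂})_{j₁ < j₂}` are
`⟨e_{j₁} ∧ e_{j₂} | ρ⁽²⁾ e_{k₁} ∧ e_{k₂}⟩ = f(a_{k₁}* a_{k₂}* a_{j₂} a_{j₁})`,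
extended by zero on the orthogonal complement of `ℋ_s ∧ ℋ_s`. -/
def twoBody {d : ℕ} (f : (Fock (Fin d) →L[ℂ] Fock (Fin d)) → ℂ) :
    Matrix (Fin d × Fin d) (Fin d × Fin d) ℂ :=
  ∑ j with j.1 < j.2, ∑ k with k.1 < k.2,
    f (create (basisOne k.1) * create (basisOne k.2) *
        annih (basisOne j.2) * annih (basisOne j.1)) •
      Matrix.vecMulVec (wedge j) (star (wedge k))

/-- The orthogonal projection `P_A` of `ℋ_s ⊗ ℋ_s` onto `ℋ_s ∧ ℋ_s`, half the difference of the
identity and the flip. -/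
def antisymProj (d : ℕ) : Matrix (Fin d × Fin d) (Fin d × Fin d) ℂ :=
  (1 / 2 : ℂ) • (1 - Matrix.of fun j k => if j = k.swap then 1 else 0)

/-- The projection `|e_0⟩⟨e_0|`. -/
def proj0 (d : ℕ) [NeZero d] : Matrix (Fin d) (Fin d) ℂ := Matrix.single 0 0 1

/-- `𝕄 = W (1 + (cos α - 1) |e_0⟩⟨e_0|)`. -/
def matM {d : ℕ} [NeZero d] (W : Matrix (Fin d) (Fin d) ℂ) (α : ℝ) : Matrix (Fin d) (Fin d) ℂ :=
  W * (1 + ((Real.cos α : ℂ) - 1) • proj0 d)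

/-- `𝔹 = W (σ sin²α |e_0⟩⟨e_0|) W*`. -/
def matB {d : ℕ} [NeZero d] (W : Matrix (Fin d) (Fin d) ℂ) (α σ : ℝ) :
    Matrix (Fin d) (Fin d) ℂ :=
  W * (((σ * Real.sin α ^ 2 : ℝ) : ℂ) • proj0 d) * W.conjTranspose

/-- `ℕ = W P^⊥`, with `P^⊥ = 1 - |e_0⟩⟨e_0|`. -/
def matN {d : ℕ} [NeZero d] (W : Matrix (Fin d) (Fin d) ℂ) : Matrix (Fin d) (Fin d) ℂ :=
  W * (1 - proj0 d)

/-- `P_A 𝕄^{⊗2} P_A`. -/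
def matM2 {d : ℕ} [NeZero d] (W : Matrix (Fin d) (Fin d) ℂ) (α : ℝ) :
    Matrix (Fin d × Fin d) (Fin d × Fin d) ℂ :=
  antisymProj d * (matM W α ⊗ₖ matM W α) * antisymProj d

/-- `P_A 𝕄*^{⊗2} P_A`. -/
def matM2Star {d : ℕ} [NeZero d] (W : Matrix (Fin d) (Fin d) ℂ) (α : ℝ) :
    Matrix (Fin d × Fin d) (Fin d × Fin d) ℂ :=
  antisymProj d * ((matM W α).conjTranspose ⊗ₖ (matM W α).conjTranspose) * antisymProj d

/-- `2 P_A (𝔹 ⊗ (ℕ R ℕ*)) P_A`. -/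
def source {d : ℕ} [NeZero d] (W : Matrix (Fin d) (Fin d) ℂ) (α σ : ℝ)
    (R : Matrix (Fin d) (Fin d) ℂ) : Matrix (Fin d × Fin d) (Fin d × Fin d) ℂ :=
  (2 : ℂ) • (antisymProj d * (matB W α σ ⊗ₖ (matN W * R * (matN W).conjTranspose)) *
    antisymProj d)

end FermionWalk

end

/-! The sample meets a fresh reservoir site at every step, so its state evolves by iterating one
fixed map. Writing `H` for the interaction, `H³ = H`, hence the coupling is `1 + (cos α - 1) H² - i
sin α H` (`coupling_eq`). Conjugating `1 ⊗ A'`, where `A' = Γ(W)* A Γ(W)`, gives a sum of four terms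
whose reservoir factors are `b₀* b₀`, `b₀ b₀*`, `b₀*` and `b₀` (`star_coupling_mul_mul_coupling`).

After `t` further steps these factors sit at site `t`: the dressed operators `b₀ ⊗ (-1)^N` and `b₀*
⊗ (-1)^N` pass through `U^t` and become `b_t ⊗ (-1)^N` and `b_t* ⊗ (-1)^N`, because the shift moves
them away from the coupled site. A sample observable evolved for `t` steps only involves reservoir
sites below `t` (`evolve_mem_blockAlg`). Since the density is `σ` times the identity, the
determinant formula makes site `t` independent of these: the odd terms have expectation zero, `b_t*
b_t` contributes `σ` and `b_t b_t*` contributes `1 - σ`. So `ρ_{t+1}(A) = ρ_t(Φ(A'))` with an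
explicit map `Φ` on sample operators (`sampleFunctional_succ`).

It remains to evaluate `Φ` on `a*(u) a*(v) a(x) a(y)`. Splitting each vector into its `e₀` component
and the rest, the CAR give the same product with all `e₀` components multiplied by `cos α`, plus `σ
sin² α` times the terms in which one creator and one annihilator are replaced by their `e₀`
coefficients (`coupling_average_eq`). The first part is the congruence by `𝕄 ⊗ 𝕄`. The second places
`𝔹` on the replaced pair and the one-body matrix, compressed by `W P^⊥`, on the other,
antisymmetrized. Iterating the affine recursion gives the closed formula. -/

noncomputable section

namespace FermionWalk

/-! ### Canonical anticommutation relations -/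

section CAR

variable {ι : Type} [LinearOrder ι]

lemma basisVec_apply (I J : Finset ι) : basisVec I J = if J = I then 1 else 0 := by
  rw [basisVec, lp.single_apply, Pi.single_apply]

lemma inner_basisVec (I : Finset ι) (f : Fock ι) : ⟪basisVec I, f⟫_ℂ = f I := by
  rw [basisVec, lp.inner_single_left]
  simp

lemma inner_basisVec_basisVec (I J : Finset ι) :
    ⟪(basisVec I : Fock ι), basisVec J⟫_ℂ = if I = J then 1 else 0 := by
  rw [inner_basisVec, basisVec_apply]

lemma sgn_mul_self (j : ι) (I : Finset ι) : sgn j I * sgn j I = 1 := by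
  rw [sgn, ← mul_pow]
  simp

lemma sgn_insert {i : ι} (j : ι) {I : Finset ι} (h : i ∉ I) :
    sgn j (insert i I) = (if i < j then -1 else 1) * sgn j I := by
  rw [sgn, sgn, Finset.filter_insert]
  split_ifs with hij
  · rw [Finset.card_insert_of_notMem (by simp [h]), pow_succ']
  · rw [one_mul]

lemma sgn_erase {i : ι} (j : ι) {I : Finset ι} (h : i ∈ I) :
    sgn j (I.erase i) = (if i < j then -1 else 1) * sgn j I := by
  conv_rhs => rw [← Finset.insert_erase h, sgn_insert j (Finset.notMem_erase i I)]
  split_ifs <;> simp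

lemma star_sgn (j : ι) (I : Finset ι) : star (sgn j I) = sgn j I := by
  simp [sgn]

/-- The annihilation operator `c(e_j)` on coefficients. -/
def annihAt (j : ι) : Fock ι →L[ℂ] Fock ι :=
  weightedComp (fun I => if j ∈ I then 0 else sgn j I) (fun I => insert j I)
    (fun I => by
      split_ifs
      · simp
      · exact (norm_sgn j I).le)
    (fun I J hI hJ h => by
      have hI' : j ∉ I := by by_contra h'; simp [h'] at hI
      have hJ' : j ∉ J := by by_contra h'; simp [h'] at hJ
      rw [← Finset.erase_insert hI', h, Finset.erase_insert hJ'])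

lemma createAt_apply (j : ι) (f : Fock ι) (I : Finset ι) :
    createAt j f I = (if j ∈ I then sgn j I else 0) * f (I.erase j) := rfl

lemma annihAt_apply (j : ι) (f : Fock ι) (I : Finset ι) :
    annihAt j f I = (if j ∈ I then 0 else sgn j I) * f (insert j I) := rfl

lemma createAt_basisVec (j : ι) (I : Finset ι) :
    createAt j (basisVec I) = (if j ∈ I then 0 else sgn j I) • basisVec (insert j I) := by
  ext J
  rw [createAt_apply, lp.coeFn_smul, Pi.smul_apply, basisVec_apply, basisVec_apply, smul_eq_mul]
  by_cases hI : j ∈ I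
  · have : J.erase j ≠ I := fun h => Finset.notMem_erase j J (h ▸ hI)
    simp [hI, this]
  · by_cases hJ : J = insert j I
    · subst hJ
      rw [sgn_insert j hI]
      simp [hI]
    · have : j ∈ J → J.erase j ≠ I := fun h h' => hJ (by rw [← h', Finset.insert_erase h])
      simp only [hJ, if_false, mul_zero]
      by_cases h : j ∈ J
      · simp [this h]
      · simp [h]

/-- With the adjoint given explicitly on coefficients, the CAR become sign bookkeeping on finite
sets. -/
lemma annihAt_eq_star (j : ι) : annihAt j = star (createAt j) := by
  ext f I
  rw [← inner_basisVec I (star (createAt j) f), ContinuousLinearMap.star_eq_adjoint,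
    ContinuousLinearMap.adjoint_inner_right, createAt_basisVec, inner_smul_left, inner_basisVec,
    annihAt_apply]
  split_ifs
  · simp
  · rw [starRingEnd_apply, star_sgn]

lemma star_annihAt (j : ι) : star (annihAt j) = createAt j := by
  rw [annihAt_eq_star, star_star]

lemma star_createAt (j : ι) : star (createAt j) = annihAt j := (annihAt_eq_star j).symm

lemma annih_basisOne (j : ι) : annih (basisOne j) = annihAt j := by
  rw [annih, create_basisOne, star_createAt]

/-- Both orders remove the same two elements. Erasing the smaller one changes by one the number of
elements below the larger one, while erasing the larger one does not affect the smaller; this is the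
relative sign. -/
lemma createAt_mul_createAt (i j : ι) : createAt i * createAt j = -(createAt j * createAt i) := by
  rw [eq_neg_iff_add_eq_zero]
  ext f I
  change (if i ∈ I then sgn i I else 0) * ((if j ∈ I.erase i then sgn j (I.erase i) else 0) *
      f ((I.erase i).erase j)) + (if j ∈ I then sgn j I else 0) *
      ((if i ∈ I.erase j then sgn i (I.erase j) else 0) * f ((I.erase j).erase i)) = 0
  rcases eq_or_ne i j with rfl | hij
  · simp
  · rw [Finset.erase_right_comm (a := j)]
    by_cases hi : i ∈ I
    · by_cases hj : j ∈ I
      · rw [sgn_erase j hi, sgn_erase i hj]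
        rcases lt_or_gt_of_ne hij with h | h
        · simp only [hi, hj, Finset.mem_erase, hij, hij.symm, h, h.not_gt, if_true, if_false,
            ne_eq, not_false_eq_true, and_self]
          ring
        · simp only [hi, hj, Finset.mem_erase, hij, hij.symm, h, h.not_gt, if_true, if_false,
            ne_eq, not_false_eq_true, and_self]
          ring
      · simp [hj]
    · simp [hi]

/-- For `i = j` exactly one of the two terms survives, according to whether `i ∈ I`, and its sign is
squared. For `i ≠ j` the signs are opposite, as for two creators. -/
lemma annihAt_mul_createAt_add (i j : ι) :
    annihAt i * createAt j + createAt j * annihAt i = if i = j then 1 else 0 := by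
  ext f I
  have h0 : (annihAt i * createAt j + createAt j * annihAt i) f I =
    (if i ∈ I then 0 else sgn i I) * ((if j ∈ insert i I then sgn j (insert i I) else 0) *
      f ((insert i I).erase j)) + (if j ∈ I then sgn j I else 0) *
      ((if i ∈ I.erase j then 0 else sgn i (I.erase j)) * f (insert i (I.erase j))) := rfl
  rw [h0]
  rcases eq_or_ne i j with rfl | hij
  · by_cases hi : i ∈ I
    · simp [hi, sgn_erase, ← mul_assoc, sgn_mul_self]
    · simp [hi, sgn_insert, ← mul_assoc, sgn_mul_self]
  · rw [Finset.erase_insert_of_ne hij]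
    by_cases hi : i ∈ I
    · simp [hi, hij]
    · by_cases hj : j ∈ I
      · rw [sgn_insert j hi, sgn_erase i hj]
        rcases lt_or_gt_of_ne hij with h | h
        · simp only [hi, hj, Finset.mem_erase, Finset.mem_insert, hij, h, h.not_gt, if_true,
            if_false, and_false, or_true]
          simp
          ring
        · simp only [hi, hj, Finset.mem_erase, Finset.mem_insert, hij, h, h.not_gt, if_true,
            if_false, and_false, or_true]
          simp
          ring
      · simp [hj, hij, hij.symm]

lemma annihAt_mul_createAt (i j : ι) :
    annihAt i * createAt j = (if i = j then 1 else 0) - createAt j * annihAt i :=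
  eq_sub_of_add_eq (annihAt_mul_createAt_add i j)

lemma annihAt_mul_annihAt (i j : ι) : annihAt i * annihAt j = -(annihAt j * annihAt i) := by
  rw [annihAt_eq_star, annihAt_eq_star, ← star_mul, createAt_mul_createAt, star_neg, star_mul]

lemma annihAt_vacuum (j : ι) : annihAt j (vacuum ι) = 0 := by
  ext I
  rw [annihAt_apply, vacuum, basisVec_apply, if_neg (Finset.insert_ne_empty j I), mul_zero]
  rfl

lemma eq_zero_of_eq_neg {A : Type*} [AddCommGroup A] [Module ℂ A] {x : A} (h : x = -x) :
    x = 0 := by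
  have h2 : (2 : ℂ) • x = 0 := by
    rw [two_smul]
    exact eq_neg_iff_add_eq_zero.mp h
  exact (smul_eq_zero.mp h2).resolve_left two_ne_zero

lemma createAt_mul_self (j : ι) : createAt j * createAt j = 0 :=
  eq_zero_of_eq_neg (createAt_mul_createAt j j)

lemma annihAt_mul_self (j : ι) : annihAt j * annihAt j = 0 :=
  eq_zero_of_eq_neg (annihAt_mul_annihAt j j)

end CAR

/-! ### Operators on the joint system -/

section Joint

variable {d : ℕ}

lemma fock_eq_sum (v : Fock (Fin d)) : v = ∑ I, v I • basisVec I := by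
  ext J
  rw [lp.coeFn_sum, Finset.sum_apply, Finset.sum_eq_single J]
  · simp [basisVec_apply]
  · intro I _ hI
    simp [basisVec_apply, hI.symm]
  · simp

lemma ext_basisVec {T T' : Fock (Fin d) →L[ℂ] Fock (Fin d)}
    (h : ∀ I, T (basisVec I) = T' (basisVec I)) : T = T' := by
  ext1 v
  rw [fock_eq_sum v]
  simp only [map_sum, map_smul, h]

lemma inner_mul_basisVec (C C' : Fock (Fin d) →L[ℂ] Fock (Fin d)) (I J : Finset (Fin d)) :
    ⟪basisVec I, (C * C') (basisVec J)⟫_ℂ =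
      ∑ K, ⟪basisVec I, C (basisVec K)⟫_ℂ * ⟪basisVec K, C' (basisVec J)⟫_ℂ := by
  change ⟪basisVec I, C (C' (basisVec J))⟫_ℂ = _
  conv_lhs => rw [fock_eq_sum (C' (basisVec J))]
  simp only [map_sum, map_smul, inner_sum, inner_smul_right, inner_basisVec]
  exact Finset.sum_congr rfl fun K _ => mul_comm _ _

/-- Inserting the resolution of the identity on both sides recovers an operator from its blocks;
identities for `tens` then reduce to scalar matrix identities. -/
lemma ext_block {X Y : Joint d →L[ℂ] Joint d} (h : ∀ I J, block I J X = block I J Y) :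
    X = Y := by
  have key : ∀ Z : Joint d →L[ℂ] Joint d,
      Z = ∑ I, ∑ J, (slot I).adjoint ∘L block I J Z ∘L slot J := fun Z => by
    calc Z = (1 : Joint d →L[ℂ] Joint d) ∘L Z ∘L (1 : Joint d →L[ℂ] Joint d) := rfl
      _ = _ := by
        rw [← sum_adjoint_comp_slot d]
        ext1 ψ
        simp only [block, map_sum, ContinuousLinearMap.comp_apply, sum_apply]
        exact Finset.sum_comm
  rw [key X, key Y]
  simp only [h]

lemma tens_mul (A A' : Fock ℤ →L[ℂ] Fock ℤ) (C C' : Fock (Fin d) →L[ℂ] Fock (Fin d)) :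
    tens A C * tens A' C' = tens (A * A') (C * C') := by
  refine ext_block fun I J => ?_
  simp only [block_mul, block_tens, inner_mul_basisVec, Finset.sum_smul, smul_mul_smul_comm]

lemma tens_one_one : tens 1 1 = (1 : Joint d →L[ℂ] Joint d) := by
  refine ext_block fun I J => ?_
  rw [block_tens, block_one]
  change ⟪basisVec I, basisVec J⟫_ℂ • _ = _
  rw [inner_basisVec_basisVec]
  split_ifs <;> simp

lemma tens_star (A : Fock ℤ →L[ℂ] Fock ℤ) (C : Fock (Fin d) →L[ℂ] Fock (Fin d)) :
    star (tens A C) = tens (star A) (star C) := by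
  refine ext_block fun I J => ?_
  rw [block_star, block_tens, block_tens, star_smul]
  congr 1
  rw [ContinuousLinearMap.star_eq_adjoint, ContinuousLinearMap.adjoint_inner_right]
  exact inner_conj_symm _ _

lemma tens_add_left (A A' : Fock ℤ →L[ℂ] Fock ℤ) (C : Fock (Fin d) →L[ℂ] Fock (Fin d)) :
    tens (A + A') C = tens A C + tens A' C := by
  refine ext_block fun I J => ?_
  simp only [block_add, block_tens, smul_add]

lemma tens_add_right (A : Fock ℤ →L[ℂ] Fock ℤ) (C C' : Fock (Fin d) →L[ℂ] Fock (Fin d)) :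
    tens A (C + C') = tens A C + tens A C' := by
  refine ext_block fun I J => ?_
  simp [block_add, block_tens, add_smul]

lemma tens_smul_left (c : ℂ) (A : Fock ℤ →L[ℂ] Fock ℤ) (C : Fock (Fin d) →L[ℂ] Fock (Fin d)) :
    tens (c • A) C = c • tens A C := by
  refine ext_block fun I J => ?_
  simp only [block_smul, block_tens, smul_comm c]

lemma tens_smul_right (c : ℂ) (A : Fock ℤ →L[ℂ] Fock ℤ) (C : Fock (Fin d) →L[ℂ] Fock (Fin d)) :
    tens A (c • C) = c • tens A C := by
  refine ext_block fun I J => ?_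
  simp [block_smul, block_tens, mul_smul]

/-- `A ↦ B ⊗ A` as a linear map. -/
def tensLinear (B : Fock ℤ →L[ℂ] Fock ℤ) :
    (Fock (Fin d) →L[ℂ] Fock (Fin d)) →ₗ[ℂ] (Joint d →L[ℂ] Joint d) where
  toFun := tens B
  map_add' := tens_add_right B
  map_smul' c := tens_smul_right c B

/-- `B ↦ B ⊗ C` as a linear map. -/
def tensLeftLinear (C : Fock (Fin d) →L[ℂ] Fock (Fin d)) :
    (Fock ℤ →L[ℂ] Fock ℤ) →ₗ[ℂ] (Joint d →L[ℂ] Joint d) where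
  toFun B := tens B C
  map_add' B B' := tens_add_left B B' C
  map_smul' c B := tens_smul_left c B C

lemma tens_neg_left (A : Fock ℤ →L[ℂ] Fock ℤ) (C : Fock (Fin d) →L[ℂ] Fock (Fin d)) :
    tens (-A) C = -tens A C :=
  (tensLeftLinear C).map_neg A

lemma tens_neg_right (A : Fock ℤ →L[ℂ] Fock ℤ) (C : Fock (Fin d) →L[ℂ] Fock (Fin d)) :
    tens A (-C) = -tens A C :=
  (tensLinear A).map_neg C

lemma tens_zero_left (C : Fock (Fin d) →L[ℂ] Fock (Fin d)) : tens 0 C = 0 :=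
  (tensLeftLinear C).map_zero

/-- `X ↦ block I J X` as a linear map. -/
def blockLinear (I J : Finset (Fin d)) :
    (Joint d →L[ℂ] Joint d) →ₗ[ℂ] (Fock ℤ →L[ℂ] Fock ℤ) where
  toFun := block I J
  map_add' := block_add I J
  map_smul' c := block_smul I J c

end Joint

/-! ### The coupling -/

/-- The exponential of an element with `H³ = H`. -/
lemma exp_smul_of_pow_three {A : Type*} [NormedRing A] [NormedAlgebra ℂ A] [CompleteSpace A]
    {H : A} (hH : H * H * H = H) (z : ℂ) :
    NormedSpace.exp (z • H) =
      1 + (Complex.cosh z - 1) • (H * H) + Complex.sinh z • H := by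
  -- `P`, `Q` and `1 - H * H` are the spectral projections of `H` for the eigenvalues `1`, `-1` and
  -- `0`.
  obtain ⟨P, hP⟩ : ∃ P : A, P = (1 / 2 : ℂ) • (H * H + H) := ⟨_, rfl⟩
  obtain ⟨Q, hQ⟩ : ∃ Q : A, Q = (1 / 2 : ℂ) • (H * H - H) := ⟨_, rfl⟩
  have hPP : H * P = P := by
    rw [hP, mul_smul_comm, mul_add, ← mul_assoc, hH, add_comm]
  have hQQ : H * Q = -Q := by
    rw [hQ, mul_smul_comm, mul_sub, ← mul_assoc, hH, ← smul_neg, neg_sub]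
  have hPQ : P - Q = H := by
    rw [hP, hQ, ← smul_sub, add_sub_sub_cancel, ← two_smul ℂ H, smul_smul]
    norm_num
  have hPQ' : P + Q = H * H := by
    rw [hP, hQ, ← smul_add, add_add_sub_cancel, ← two_smul ℂ (H * H), smul_smul]
    norm_num
  have hpow : ∀ n : ℕ, H ^ n = (if n = 0 then 1 - H * H else 0) + P + (-1 : ℂ) ^ n • Q := by
    intro n
    induction n with
    | zero =>
      rw [pow_zero, pow_zero, if_pos rfl, one_smul, add_assoc, hPQ', sub_add_cancel]
    | succ n ih =>
      rw [pow_succ', ih, mul_add, mul_add, mul_smul_comm, hPP, hQQ, if_neg n.succ_ne_zero,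
        pow_succ, mul_neg_one, smul_neg, neg_smul]
      split_ifs
      · rw [mul_sub, ← mul_assoc, hH, mul_one, sub_self]
      · rw [mul_zero]
  -- The eigenvalue `0` contributes to the exponential series only through the term `n = 0`.
  have h0 : HasSum (fun n : ℕ => if n = 0 then 1 - H * H else 0) (1 - H * H) :=
    hasSum_ite_eq 0 _
  have hexp : ∀ w : ℂ, HasSum (fun n : ℕ => ((n.factorial : ℂ)⁻¹ * w ^ n)) (Complex.exp w) :=
    fun w => by
      rw [Complex.exp_eq_exp_ℂ]
      exact NormedSpace.exp_series_hasSum_exp' (𝕂 := ℂ) w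
  have h1 := ((h0.add ((hexp z).smul_const P)).add ((hexp (-z)).smul_const Q))
  have h2 := NormedSpace.exp_series_hasSum_exp' (𝕂 := ℂ) (z • H)
  have heq : (fun n : ℕ => ((n.factorial : ℂ)⁻¹) • (z • H) ^ n) = fun n : ℕ =>
      (if n = 0 then 1 - H * H else 0) + ((n.factorial : ℂ)⁻¹ * z ^ n) • P +
        ((n.factorial : ℂ)⁻¹ * (-z) ^ n) • Q := by
    funext n
    have h3 : ((n.factorial : ℂ)⁻¹ * z ^ n) • (if n = 0 then 1 - H * H else 0) =
        if n = 0 then 1 - H * H else 0 := by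
      rcases eq_or_ne n 0 with rfl | hn
      · simp
      · simp [hn]
    have h4 : (n.factorial : ℂ)⁻¹ * z ^ n * (-1) ^ n = (n.factorial : ℂ)⁻¹ * (-z) ^ n := by
      rw [neg_pow z]
      ring
    rw [smul_pow, hpow, smul_smul, smul_add, smul_add, h3, smul_smul, h4]
  rw [heq] at h2
  rw [h2.unique h1]
  have hc : Complex.exp z = Complex.cosh z + Complex.sinh z := (Complex.cosh_add_sinh z).symm
  have hs : Complex.exp (-z) = Complex.cosh z - Complex.sinh z := (Complex.cosh_sub_sinh z).symm
  rw [hc, hs, ← hPQ', ← hPQ]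
  module

section Coupling

variable {d : ℕ} [NeZero d]

/-- `p = a₀* a₀`. -/
def numAt (d : ℕ) [NeZero d] : Fock (Fin d) →L[ℂ] Fock (Fin d) := createAt 0 * annihAt 0

/-- `q = a₀ a₀*`. -/
def holeAt (d : ℕ) [NeZero d] : Fock (Fin d) →L[ℂ] Fock (Fin d) := annihAt 0 * createAt 0

/-- The interaction `b₀* ⊗ a₀ + b₀ ⊗ a₀*`. -/
def interaction (d : ℕ) [NeZero d] : Joint d →L[ℂ] Joint d :=
  tens (createAt 0) (annihAt 0) + tens (annihAt 0) (createAt 0)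

lemma createAt_annihAt_createAt {ι : Type} [LinearOrder ι] (j : ι) :
    createAt j * annihAt j * createAt j = createAt j := by
  rw [mul_assoc, annihAt_mul_createAt, if_pos rfl, mul_sub, mul_one, ← mul_assoc,
    createAt_mul_self, zero_mul, sub_zero]

lemma annihAt_createAt_annihAt {ι : Type} [LinearOrder ι] (j : ι) :
    annihAt j * createAt j * annihAt j = annihAt j := by
  rw [annihAt_mul_createAt, if_pos rfl, sub_mul, one_mul, mul_assoc, annihAt_mul_self, mul_zero,
    sub_zero]

/-- The surviving cross terms form the projection onto the states with exactly one particle in the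
two modes `b₀` and `a₀`. On these the interaction moves the particle to the other mode, and
elsewhere it vanishes; hence its cube is itself. -/
lemma interaction_sq : interaction d * interaction d =
    tens (createAt 0 * annihAt 0) (holeAt d) + tens (annihAt 0 * createAt 0) (numAt d) := by
  simp only [interaction, add_mul, mul_add, tens_mul, createAt_mul_self, annihAt_mul_self,
    tens_zero_left, zero_add, add_zero, holeAt, numAt]
  exact add_comm _ _

lemma interaction_cube : interaction d * interaction d * interaction d = interaction d := by
  rw [interaction_sq]
  simp only [interaction, add_mul, mul_add, tens_mul, holeAt, numAt, mul_assoc,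
    createAt_mul_self, annihAt_mul_self, mul_zero,
    tens_zero_left, zero_add, add_zero]
  simp only [← mul_assoc, createAt_annihAt_createAt, annihAt_createAt_annihAt]

lemma coupling_eq (α : ℝ) : coupling d α = 1 +
    ((Real.cos α : ℂ) - 1) • (tens (createAt 0 * annihAt 0) (holeAt d) +
      tens (annihAt 0 * createAt 0) (numAt d)) -
    (Complex.I * (Real.sin α : ℂ)) • interaction d := by
  have hz : -(Complex.I * (α : ℂ)) = ((-α : ℝ) : ℂ) * Complex.I := by push_cast; ring
  rw [coupling, create_basisOne, create_basisOne, annih_basisOne, annih_basisOne,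
    ← interaction, exp_smul_of_pow_three interaction_cube, interaction_sq, hz,
    Complex.cosh_mul_I, Complex.sinh_mul_I, ← Complex.ofReal_cos, ← Complex.ofReal_sin,
    Real.cos_neg, Real.sin_neg]
  have h : ((-Real.sin α : ℝ) : ℂ) * Complex.I = -(Complex.I * (Real.sin α : ℂ)) := by
    push_cast
    ring
  rw [h, neg_smul, ← sub_eq_add_neg]

end Coupling

/-! ### Second quantization on the sample -/

/-- Multiplying an ordered product of anticommuting elements by one of them. -/
lemma mul_prod_map_sort {ι A : Type*} [LinearOrder ι] [Ring A] (c : ι → A)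
    (hc : ∀ i j, c i * c j = -(c j * c i)) (hc0 : ∀ i, c i * c i = 0) (j : ι) (I : Finset ι) :
    c j * ((I.sort (· ≤ ·)).map c).prod = if j ∈ I then 0 else
      (-1) ^ (I.filter fun i => i < j).card * (((insert j I).sort (· ≤ ·)).map c).prod := by
  induction I using Finset.induction_on_min with
  | empty => simp
  | insert m I hm ih =>
    have hmI : m ∉ I := fun h => (hm m h).false
    rw [Finset.sort_insert (r := (· ≤ ·)) (fun b hb => (hm b hb).le) hmI, List.map_cons,
      List.prod_cons]
    -- The factor at `m` comes first in the ordered product. If `j < m` the new factor is already in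
    -- place; if `j = m` the square vanishes; if `j > m` passing the factor at `m` costs one sign,
    -- matching the fact that `m` is counted in the exponent.
    rcases lt_trichotomy j m with h | rfl | h
    · have hjI : ∀ b ∈ insert m I, j < b := fun b hb => by
        rcases Finset.mem_insert.mp hb with rfl | hb
        · exact h
        · exact h.trans (hm b hb)
      have hj : j ∉ insert m I := fun hj => (hjI j hj).false
      have h0 : (insert m I).filter (fun i => i < j) = ∅ :=
        Finset.filter_eq_empty_iff.mpr fun b hb => (hjI b hb).not_gt
      rw [if_neg hj, h0, Finset.sort_insert (r := (· ≤ ·)) (fun b hb => (hjI b hb).le) hj,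
        Finset.sort_insert (r := (· ≤ ·)) (fun b hb => (hm b hb).le) hmI]
      simp
    · rw [← mul_assoc, hc0, zero_mul, if_pos (Finset.mem_insert_self _ _)]
    · rw [← mul_assoc, hc, neg_mul, mul_assoc, ih]
      by_cases hj : j ∈ I
      · simp [hj]
      · have hj' : j ∉ insert m I := by simp [hj, h.ne']
        have hmj : ∀ b ∈ insert j I, m < b := fun b hb => by
          rcases Finset.mem_insert.mp hb with rfl | hb
          · exact h
          · exact hm b hb
        have hmj' : m ∉ insert j I := fun hh => (hmj m hh).false
        rw [if_neg hj, if_neg hj', Finset.filter_insert, if_pos h,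
          Finset.card_insert_of_notMem (by simp [hmI]), Finset.insert_comm,
          Finset.sort_insert (r := (· ≤ ·)) (fun b hb => (hmj b hb).le) hmj', List.map_cons,
          List.prod_cons, pow_succ, ← mul_assoc, ← mul_assoc,
          ((Commute.neg_one_right (c m)).pow_right _).eq]
        simp

section SecondQuant

variable {d : ℕ}

/-- The creation operator `∑ u_l a_l*`. -/
def createVec (u : Fin d → ℂ) : Fock (Fin d) →L[ℂ] Fock (Fin d) := ∑ l, u l • createAt l

/-- The annihilation operator `∑ conj(u_l) a_l`. -/
def annihVec (u : Fin d → ℂ) : Fock (Fin d) →L[ℂ] Fock (Fin d) := ∑ l, star (u l) • annihAt l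

lemma create_eq_createVec (u : Fin d → ℂ) (h : Memℓp (fun i => u i) 2) :
    create (⟨u, h⟩ : OneParticle (Fin d)) = createVec u := by
  rw [create, tsum_fintype]
  rfl

lemma star_createVec (u : Fin d → ℂ) : star (createVec u) = annihVec u := by
  simp only [createVec, annihVec, star_sum, star_smul, star_createAt]

lemma createVec_mul_createVec (u v : Fin d → ℂ) :
    createVec u * createVec v = -(createVec v * createVec u) := by
  simp only [createVec, Finset.sum_mul, Finset.mul_sum, ← Finset.sum_neg_distrib]
  rw [Finset.sum_comm]
  refine Finset.sum_congr rfl fun i _ => Finset.sum_congr rfl fun j _ => ?_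
  rw [smul_mul_smul_comm, smul_mul_smul_comm, createAt_mul_createAt, smul_neg, mul_comm]

lemma annihVec_mul_createVec (u v : Fin d → ℂ) :
    annihVec u * createVec v = (∑ l, star (u l) * v l) • 1 - createVec v * annihVec u := by
  simp only [createVec, annihVec, Finset.sum_mul, Finset.mul_sum, smul_mul_smul_comm,
    annihAt_mul_createAt, smul_sub, Finset.sum_sub_distrib, Finset.sum_smul]
  congr 1
  · refine Finset.sum_congr rfl fun i _ => ?_
    rw [Finset.sum_eq_single i]
    · simp
    · intro j _ hj
      simp [hj]
    · simp
  · rw [Finset.sum_comm]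
    simp only [mul_comm]

lemma annihVec_vacuum (u : Fin d → ℂ) : annihVec u (vacuum (Fin d)) = 0 := by
  simp [annihVec, sum_apply, annihAt_vacuum]

lemma basisVec_insert {j : Fin d} {I : Finset (Fin d)} (h : j ∉ I) :
    basisVec (insert j I) = sgn j I • createAt j (basisVec I) := by
  rw [createAt_basisVec, if_neg h, smul_smul, sgn_mul_self, one_smul]

/-- An operator that annihilates the vacuum and anticommutes, up to a modification on the left,
with all creation operators vanishes. -/
lemma eq_zero_of_vacuum {D : Fock (Fin d) →L[ℂ] Fock (Fin d)}
    (B : Fin d → Fock (Fin d) →L[ℂ] Fock (Fin d)) (h0 : D (vacuum (Fin d)) = 0)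
    (h : ∀ j, D * createAt j = B j * D) : D = 0 := by
  refine ext_basisVec fun I => ?_
  induction I using Finset.induction_on with
  | empty => exact h0
  | insert j I hj ih =>
    have h1 : D (createAt j (basisVec I)) = B j (D (basisVec I)) :=
      congrArg (fun T : Fock (Fin d) →L[ℂ] Fock (Fin d) => T (basisVec I)) (h j)
    rw [basisVec_insert hj, map_smul, h1, ih]
    simp

variable (W : Matrix (Fin d) (Fin d) ℂ)

lemma secondQuant_basisVec (I : Finset (Fin d)) : secondQuant W (basisVec I) =
    ((I.sort (· ≤ ·)).map fun i => createVec fun j => W j i).prod (vacuum (Fin d)) := by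
  simp only [secondQuant, sum_apply, ContinuousLinearMap.smulRight_apply, innerSL_apply_apply,
    create_eq_createVec, inner_basisVec_basisVec, ite_smul, one_smul, zero_smul]
  rw [Finset.sum_ite_eq' Finset.univ I]
  simp

lemma secondQuant_vacuum : secondQuant W (vacuum (Fin d)) = vacuum (Fin d) := by
  rw [vacuum, secondQuant_basisVec]
  simp [vacuum]

/-- On a basis vector both sides insert one factor into the ordered product of the anticommuting
operators `c*(W e_i)`, and reordering costs the same sign as for the `c*(e_i)`. Unitarity plays no
role. -/
lemma secondQuant_mul_createAt (j : Fin d) :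
    secondQuant W * createAt j = createVec (fun k => W k j) * secondQuant W := by
  refine ext_basisVec fun I => ?_
  change secondQuant W (createAt j (basisVec I)) =
    createVec (fun k => W k j) (secondQuant W (basisVec I))
  have h := mul_prod_map_sort (fun i : Fin d => createVec fun k => W k i)
    (fun _ _ => createVec_mul_createVec _ _)
    (fun _ => eq_zero_of_eq_neg (createVec_mul_createVec _ _)) j I
  have h' := congrArg (fun T : Fock (Fin d) →L[ℂ] Fock (Fin d) => T (vacuum (Fin d))) h
  rw [secondQuant_basisVec, createAt_basisVec]
  refine Eq.trans ?_ h'.symm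
  split_ifs
  · simp
  · rw [map_smul, secondQuant_basisVec, sgn]
    -- The sign is a complex scalar on one side and a power of the operator `-1` on the other.
    rcases Nat.even_or_odd (I.filter fun i => i < j).card with h1 | h1 <;>
    simp [h1.neg_one_pow]

/-- The parity `(-1)^N` of the sample. -/
def parity (d : ℕ) : Fock (Fin d) →L[ℂ] Fock (Fin d) :=
  weightedComp (fun I => (-1) ^ I.card) id (fun _ => by simp) (fun _ _ _ _ h => h)

lemma parity_apply (f : Fock (Fin d)) (I : Finset (Fin d)) :
    parity d f I = (-1) ^ I.card * f I := rfl

lemma parity_mul_self : parity d * parity d = 1 := by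
  ext f I
  change (-1) ^ I.card * ((-1) ^ I.card * f I) = f I
  rw [← mul_assoc, ← mul_pow]
  simp

lemma star_parity : star (parity d) = parity d := by
  ext f I
  rw [← inner_basisVec I (star (parity d) f), ContinuousLinearMap.star_eq_adjoint,
    ContinuousLinearMap.adjoint_inner_right]
  have : parity d (basisVec I) = (-1 : ℂ) ^ I.card • basisVec I := by
    ext J
    rw [parity_apply, lp.coeFn_smul, Pi.smul_apply, basisVec_apply, smul_eq_mul]
    split_ifs with h
    · rw [h]
    · rw [mul_zero, mul_zero]
  rw [this, inner_smul_left, inner_basisVec, parity_apply]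
  simp

lemma parity_mul_createAt (j : Fin d) : parity d * createAt j = -(createAt j * parity d) := by
  ext f I
  change (-1) ^ I.card * ((if j ∈ I then sgn j I else 0) * f (I.erase j)) =
    -((if j ∈ I then sgn j I else 0) * ((-1) ^ (I.erase j).card * f (I.erase j)))
  split_ifs with h
  · rw [← Finset.card_erase_add_one h, pow_succ]
    ring
  · simp

lemma parity_mul_annihAt (j : Fin d) : parity d * annihAt j = -(annihAt j * parity d) := by
  have := congrArg star (parity_mul_createAt j)
  rw [star_neg, star_mul, star_mul, star_parity, star_createAt] at this
  rw [this, neg_neg]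

lemma parity_vacuum : parity d (vacuum (Fin d)) = vacuum (Fin d) := by
  ext I
  rw [parity_apply, vacuum, basisVec_apply]
  split_ifs with h
  · simp [h]
  · simp

/-- `Γ(W)` preserves the particle number. Formally, the commutator kills the vacuum and passes every
creation operator up to a factor on the left, so `eq_zero_of_vacuum` applies. -/
lemma parity_mul_secondQuant : parity d * secondQuant W = secondQuant W * parity d := by
  have hp : ∀ u : Fin d → ℂ, parity d * createVec u = -(createVec u * parity d) := fun u => by
    simp only [createVec, Finset.sum_mul, Finset.mul_sum, mul_smul_comm, smul_mul_assoc,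
      parity_mul_createAt, smul_neg, Finset.sum_neg_distrib]
  rw [← sub_eq_zero]
  refine eq_zero_of_vacuum (fun j => -createVec fun k => W k j) ?_ fun j => ?_
  · change parity d (secondQuant W (vacuum (Fin d))) -
      secondQuant W (parity d (vacuum (Fin d))) = 0
    rw [secondQuant_vacuum, parity_vacuum, secondQuant_vacuum, sub_self]
  · rw [sub_mul, mul_assoc, mul_assoc, secondQuant_mul_createAt, parity_mul_createAt, mul_neg,
      ← mul_assoc, ← mul_assoc, hp, secondQuant_mul_createAt]
    noncomm_ring

/-! ### Intertwining relations and the isometry property of `Γ(W)` for unitary `W` -/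

variable {W}

lemma sum_star_mul_of_unitary (hW : W ∈ Matrix.unitaryGroup (Fin d) ℂ) (i j : Fin d) :
    ∑ l, star (W l i) * W l j = if i = j then 1 else 0 := by
  have h := congrFun (congrFun (Matrix.mem_unitaryGroup_iff'.mp hW) i) j
  rwa [Matrix.mul_apply, Matrix.one_apply] at h

lemma sum_mul_star_of_unitary (hW : W ∈ Matrix.unitaryGroup (Fin d) ℂ) (i j : Fin d) :
    ∑ l, W i l * star (W j l) = if i = j then 1 else 0 := by
  have h := congrFun (congrFun (Matrix.mem_unitaryGroup_iff.mp hW) i) j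
  rwa [Matrix.mul_apply, Matrix.one_apply] at h

/-- Moving a creation operator through the difference of the two sides produces the contractions `⟨W
e_j, W e_i⟩` and `⟨e_j, e_i⟩`, which cancel because `W` is isometric; what is left again kills the
vacuum. -/
lemma annihVec_mul_secondQuant (hW : W ∈ Matrix.unitaryGroup (Fin d) ℂ) (j : Fin d) :
    annihVec (fun k => W k j) * secondQuant W = secondQuant W * annihAt j := by
  rw [← sub_eq_zero]
  refine eq_zero_of_vacuum (fun i => -createVec fun k => W k i) ?_ fun i => ?_
  · change annihVec (fun k => W k j) (secondQuant W (vacuum (Fin d))) -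
      secondQuant W (annihAt j (vacuum (Fin d))) = 0
    rw [secondQuant_vacuum, annihAt_vacuum, annihVec_vacuum, map_zero, sub_self]
  · rw [sub_mul, mul_assoc, mul_assoc, secondQuant_mul_createAt, annihAt_mul_createAt, mul_sub,
      ← mul_assoc, ← mul_assoc, annihVec_mul_createVec, sum_star_mul_of_unitary hW,
      secondQuant_mul_createAt]
    split_ifs
    · rw [one_smul]
      noncomm_ring
    · rw [zero_smul]
      noncomm_ring

lemma star_secondQuant_mul (hW : W ∈ Matrix.unitaryGroup (Fin d) ℂ) :
    star (secondQuant W) * secondQuant W = 1 := by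
  have h1 : ∀ j, star (secondQuant W) * createVec (fun k => W k j) =
      createAt j * star (secondQuant W) := fun j => by
    have := congrArg star (annihVec_mul_secondQuant hW j)
    rwa [star_mul, star_mul, star_annihAt, ← star_createVec, star_star] at this
  -- A basis vector containing `j` is mapped by `Γ(W)` into the range of a creation operator, which
  -- is orthogonal to the vacuum. Hence only the vacuum coefficient of `Γ(W)* Ω` survives.
  have h2 : star (secondQuant W) (vacuum (Fin d)) = vacuum (Fin d) := by
    ext I
    rw [← inner_basisVec, ← inner_basisVec, ContinuousLinearMap.star_eq_adjoint,
      ContinuousLinearMap.adjoint_inner_right]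
    rcases I.eq_empty_or_nonempty with rfl | ⟨j, hj⟩
    · exact congrArg (fun v => ⟪v, _⟫_ℂ) (secondQuant_vacuum W)
    · have h3 : secondQuant W (createAt j (basisVec (I.erase j))) =
          createVec (fun k => W k j) (secondQuant W (basisVec (I.erase j))) :=
        congrArg (fun T : Fock (Fin d) →L[ℂ] Fock (Fin d) => T (basisVec (I.erase j)))
          (secondQuant_mul_createAt W j)
      rw [← Finset.insert_erase hj, basisVec_insert (Finset.notMem_erase j I), map_smul, h3,
        inner_smul_left, inner_smul_left, ← star_annihAt, ← star_star (createVec _),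
        star_createVec, ContinuousLinearMap.star_eq_adjoint, ContinuousLinearMap.star_eq_adjoint,
        ContinuousLinearMap.adjoint_inner_left, ContinuousLinearMap.adjoint_inner_left,
        annihVec_vacuum, annihAt_vacuum, inner_zero_right, inner_zero_right]
  rw [← sub_eq_zero]
  refine eq_zero_of_vacuum createAt ?_ fun j => ?_
  · change star (secondQuant W) (secondQuant W (vacuum (Fin d))) - vacuum (Fin d) = 0
    rw [secondQuant_vacuum, h2, sub_self]
  · rw [sub_mul, mul_assoc, secondQuant_mul_createAt, ← mul_assoc, h1, mul_sub, mul_assoc, one_mul,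
      mul_one]

/-- Since `W W* = 1`, one has `e_k = ∑ j, conj(W k j) W e_j`; this inverts
`secondQuant_mul_createAt`. -/
lemma createAt_mul_secondQuant (hW : W ∈ Matrix.unitaryGroup (Fin d) ℂ) (k : Fin d) :
    createAt k * secondQuant W = secondQuant W * createVec fun l => star (W k l) := by
  simp only [createVec, Finset.mul_sum, mul_smul_comm, secondQuant_mul_createAt, Finset.sum_mul,
    smul_mul_assoc, Finset.smul_sum, smul_smul]
  rw [Finset.sum_comm, Finset.sum_eq_single k]
  · simp only [← Finset.sum_smul, mul_comm (star _), sum_mul_star_of_unitary hW, if_true,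
      one_smul]
  · intro j _ hj
    simp only [← Finset.sum_smul, mul_comm (star _), sum_mul_star_of_unitary hW, if_neg hj,
      zero_smul]
  · simp

lemma annihAt_mul_secondQuant (hW : W ∈ Matrix.unitaryGroup (Fin d) ℂ) (k : Fin d) :
    annihAt k * secondQuant W = secondQuant W * annihVec fun l => star (W k l) := by
  simp only [annihVec, Finset.mul_sum, mul_smul_comm, ← annihVec_mul_secondQuant hW,
    Finset.sum_mul, smul_mul_assoc, Finset.smul_sum, smul_smul, star_star]
  rw [Finset.sum_comm, Finset.sum_eq_single k]
  · simp only [← Finset.sum_smul, sum_mul_star_of_unitary hW, if_true, one_smul]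
  · intro j _ hj
    simp only [← Finset.sum_smul, sum_mul_star_of_unitary hW, if_neg hj.symm,
      zero_smul]
  · simp

end SecondQuant

/-! ### The local algebras of the reservoir -/

/-- The *-algebra generated by the creation operators at the sites below `n`. -/
def locAlg (n : ℤ) : StarSubalgebra ℂ (Fock ℤ →L[ℂ] Fock ℤ) :=
  StarAlgebra.adjoin ℂ (createAt '' Set.Iio n)

lemma createAt_mem_locAlg {j n : ℤ} (h : j < n) : createAt j ∈ locAlg n :=
  StarAlgebra.subset_adjoin ℂ _ ⟨j, h, rfl⟩

lemma annihAt_mem_locAlg {j n : ℤ} (h : j < n) : annihAt j ∈ locAlg n := by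
  rw [annihAt_eq_star]
  exact star_mem (createAt_mem_locAlg h)

/-- The span of the normally ordered monomials over the sites below `n`. -/
def normalSpan (n : ℤ) : Submodule ℂ (Fock ℤ →L[ℂ] Fock ℤ) :=
  Submodule.span ℂ {Y | ∃ C D : List ℤ, (∀ j ∈ C, j < n) ∧ (∀ j ∈ D, j < n) ∧
    Y = (C.map createAt).prod * (D.map annihAt).prod}

lemma monomial_mem_normalSpan {n : ℤ} {C D : List ℤ} (hC : ∀ j ∈ C, j < n)
    (hD : ∀ j ∈ D, j < n) : (C.map createAt).prod * (D.map annihAt).prod ∈ normalSpan n :=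
  Submodule.subset_span ⟨C, D, hC, hD, rfl⟩

lemma createAt_mul_mem_normalSpan {n j : ℤ} (hj : j < n) {Z : Fock ℤ →L[ℂ] Fock ℤ}
    (hZ : Z ∈ normalSpan n) : createAt j * Z ∈ normalSpan n := by
  induction hZ using Submodule.span_induction with
  | mem Z hZ =>
    obtain ⟨C, D, hC, hD, rfl⟩ := hZ
    have := monomial_mem_normalSpan (n := n) (C := j :: C) (D := D) (by simpa [hj] using hC) hD
    simpa [mul_assoc] using this
  | zero => rw [mul_zero]; exact zero_mem _
  | add x y _ _ hx hy => rw [mul_add]; exact add_mem hx hy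
  | smul c x _ hx => rw [mul_smul_comm]; exact Submodule.smul_mem _ c hx

/-- Induction on the number of creators: the annihilator passes the first one, leaving a contraction
with one creator fewer and a term with that creator in front. -/
lemma annihAt_mul_mem_normalSpan {n j : ℤ} (hj : j < n) {Z : Fock ℤ →L[ℂ] Fock ℤ}
    (hZ : Z ∈ normalSpan n) : annihAt j * Z ∈ normalSpan n := by
  induction hZ using Submodule.span_induction with
  | mem Z hZ =>
    obtain ⟨C, D, hC, hD, rfl⟩ := hZ
    induction C with
    | nil =>
      rw [List.map_nil, List.prod_nil, one_mul, ← List.prod_cons, ← List.map_cons]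
      have := monomial_mem_normalSpan (n := n) (C := []) (D := j :: D) (by simp)
        (by simpa [hj] using hD)
      simpa using this
    | cons k C ih =>
      have hC' : ∀ i ∈ C, i < n := fun i hi => hC i (List.mem_cons_of_mem k hi)
      rw [List.map_cons, List.prod_cons, ← mul_assoc, ← mul_assoc, annihAt_mul_createAt, sub_mul,
        sub_mul, mul_assoc _ (annihAt j), mul_assoc (createAt k), mul_assoc (annihAt j)]
      refine sub_mem ?_ (createAt_mul_mem_normalSpan (hC k (by simp)) (ih hC'))
      split_ifs
      · rw [one_mul]
        exact monomial_mem_normalSpan hC' hD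
      · rw [zero_mul, zero_mul]
        exact zero_mem _
  | zero => rw [mul_zero]; exact zero_mem _
  | add x y _ _ hx hy => rw [mul_add]; exact add_mem hx hy
  | smul c x _ hx => rw [mul_smul_comm]; exact Submodule.smul_mem _ c hx

/-- The determinant formula evaluates a quasi-free state on normally ordered products only. Their
span contains `1` and is stable under left multiplication by the generators, hence it exhausts the
local algebra. -/
lemma mem_normalSpan_of_mem_locAlg {n : ℤ} {Y : Fock ℤ →L[ℂ] Fock ℤ} (hY : Y ∈ locAlg n) :
    Y ∈ normalSpan n := by
  have h1 : Y ∈ Algebra.adjoin ℂ (createAt '' Set.Iio n ∪ star (createAt '' Set.Iio n)) := by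
    rw [← StarAlgebra.adjoin_toSubalgebra]
    exact hY
  have h2 : ∀ Z ∈ normalSpan n, Y * Z ∈ normalSpan n := by
    clear hY
    induction h1 using Algebra.adjoin_induction with
    | mem X hX =>
      intro Z hZ
      rcases hX with ⟨j, hj, rfl⟩ | ⟨j, hj, hX⟩
      · exact createAt_mul_mem_normalSpan hj hZ
      · have : X = annihAt j := by rw [annihAt_eq_star, hX, star_star]
        rw [this]
        exact annihAt_mul_mem_normalSpan hj hZ
    | algebraMap r =>
      intro Z hZ
      rw [← Algebra.smul_def]
      exact Submodule.smul_mem _ r hZ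
    | add X X' _ _ h h' =>
      intro Z hZ
      rw [add_mul]
      exact add_mem (h Z hZ) (h' Z hZ)
    | mul X X' _ _ h h' =>
      intro Z hZ
      rw [mul_assoc]
      exact h _ (h' Z hZ)
  simpa using h2 1 (by simpa using monomial_mem_normalSpan (n := n) (C := []) (D := []))

lemma shift_conj_mem_locAlg {n : ℤ} {X : Fock ℤ →L[ℂ] Fock ℤ} (hX : X ∈ locAlg n) :
    star shiftFock * X * shiftFock ∈ locAlg (n + 1) := by
  let u : unitary (Fock ℤ →L[ℂ] Fock ℤ) := ⟨shiftFock, star_shiftFock_mul, shiftFock_mul_star⟩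
  let f : (Fock ℤ →L[ℂ] Fock ℤ) →⋆ₐ[ℂ] (Fock ℤ →L[ℂ] Fock ℤ) :=
    ((Unitary.conjStarAlgAut ℂ (Fock ℤ →L[ℂ] Fock ℤ) (star u) :
      (Fock ℤ →L[ℂ] Fock ℤ) ≃⋆ₐ[ℂ] (Fock ℤ →L[ℂ] Fock ℤ)) : _ →⋆ₐ[ℂ] _)
  have hf : ∀ Y, f Y = star shiftFock * Y * shiftFock := fun Y =>
    Unitary.conjStarAlgAut_star_apply (S := ℂ) u Y
  have hle : locAlg n ≤ (locAlg (n + 1)).comap f := by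
    refine StarAlgebra.adjoin_le ?_
    rintro _ ⟨j, hj, rfl⟩
    change f (createAt j) ∈ locAlg (n + 1)
    rw [hf, mul_assoc, createAt_mul_shiftFock, ← mul_assoc, star_shiftFock_mul, one_mul]
    exact createAt_mem_locAlg (by simpa using hj)
  rw [← hf]
  exact hle hX

lemma annihAt_mul_shiftFock (j : ℤ) :
    annihAt j * shiftFock = shiftFock * annihAt (j + 1) := by
  have h := congrArg star (createAt_mul_shiftFock j)
  rw [star_mul, star_mul, star_createAt, star_createAt] at h
  calc annihAt j * shiftFock
      = shiftFock * (star shiftFock * annihAt j) * shiftFock := by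
        rw [← mul_assoc, shiftFock_mul_star, one_mul]
    _ = shiftFock * annihAt (j + 1) := by
        rw [h, mul_assoc, mul_assoc, star_shiftFock_mul, mul_one]

lemma prod_annihAt_mul_createAt {D : List ℤ} {t : ℤ} (hD : t ∉ D) :
    (D.map annihAt).prod * createAt t =
      (-1 : ℂ) ^ D.length • (createAt t * (D.map annihAt).prod) := by
  induction D with
  | nil => simp
  | cons k D ih =>
    have hk : k ≠ t := fun h => hD (by simp [h])
    rw [List.map_cons, List.prod_cons, mul_assoc, ih fun h => hD (List.mem_cons_of_mem k h),
      mul_smul_comm, ← mul_assoc, annihAt_mul_createAt, if_neg hk, zero_sub, neg_mul, mul_assoc,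
      List.length_cons, pow_succ, mul_neg_one, neg_smul, smul_neg]

/-! ### Quasi-free states on the local algebras -/

section QuasiFree

variable {ω : resAlg →ₗ[ℂ] ℂ} {σ : ℝ}
  {F : (Fock ℤ →L[ℂ] Fock ℤ) →ₗ[ℂ] ℂ}

lemma coe_prod_resCreate {n : ℕ} (φ : Fin n → ℤ) :
    (((List.ofFn fun i => resCreate (basisOne (φ i))).reverse.prod : resAlg) :
      Fock ℤ →L[ℂ] Fock ℤ) = ((List.ofFn φ).reverse.map createAt).prod := by
  have := map_list_prod resAlg.subtype (List.ofFn fun i => resCreate (basisOne (φ i))).reverse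
  refine this.trans ?_
  rw [List.map_reverse, List.map_ofFn, List.map_reverse, List.map_ofFn]
  congr 3
  funext i
  exact create_basisOne (φ i)

lemma coe_prod_resAnnih {n : ℕ} (ψ : Fin n → ℤ) :
    (((List.ofFn fun i => resAnnih (basisOne (ψ i))).prod : resAlg) :
      Fock ℤ →L[ℂ] Fock ℤ) = ((List.ofFn ψ).map annihAt).prod := by
  have := map_list_prod resAlg.subtype (List.ofFn fun i => resAnnih (basisOne (ψ i)))
  refine this.trans ?_
  rw [List.map_ofFn, List.map_ofFn]
  congr 2
  funext i
  exact annih_basisOne (ψ i)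

lemma inner_basisOne_smul (i j : ℤ) :
    ⟪(basisOne i : OneParticle ℤ),
      ((σ : ℂ) • ContinuousLinearMap.id ℂ (OneParticle ℤ)) (basisOne j)⟫_ℂ =
        if i = j then (σ : ℂ) else 0 := by
  change ⟪(basisOne i : OneParticle ℤ), (σ : ℂ) • basisOne j⟫_ℂ = _
  rw [inner_smul_right, basisOne, basisOne, lp.inner_single_left, lp.single_apply, Pi.single_apply]
  split_ifs <;> simp

variable (hω : IsQuasiFree ω ((σ : ℂ) • ContinuousLinearMap.id ℂ (OneParticle ℤ)))
  (hF : ∀ X : resAlg, F X = ω X)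
include hω hF

lemma quasiFree_det {n : ℕ} (φ ψ : Fin n → ℤ) :
    F (((List.ofFn φ).reverse.map createAt).prod * ((List.ofFn ψ).map annihAt).prod) =
      (Matrix.of fun j k => if ψ j = φ k then (σ : ℂ) else 0).det := by
  rw [← coe_prod_resCreate, ← coe_prod_resAnnih]
  refine ((hF (_ * _)).trans (hω.eq_det n _ _)).trans ?_
  simp only [inner_basisOne_smul]

lemma quasiFree_eq_zero_of_length {C D : List ℤ} (h : C.length ≠ D.length) :
    F ((C.map createAt).prod * (D.map annihAt).prod) = 0 := by
  have h1 := coe_prod_resCreate C.reverse.get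
  have h2 := coe_prod_resAnnih D.get
  rw [List.ofFn_get, List.reverse_reverse] at h1
  rw [List.ofFn_get] at h2
  rw [← h1, ← h2]
  exact (hF (_ * _)).trans (hω.eq_zero _ _ _ _ (by simpa using h))

/-- A site that is annihilated but never created gives a zero row in the determinant; if the numbers
of creators and annihilators differ, gauge invariance gives zero. -/
lemma quasiFree_eq_zero_of_notMem_left {C D : List ℤ} {t : ℤ} (hC : t ∉ C) (hD : t ∈ D) :
    F ((C.map createAt).prod * (D.map annihAt).prod) = 0 := by
  by_cases h : C.length = D.length
  · obtain ⟨φ, hφ⟩ : ∃ φ : Fin D.length → ℤ, C.reverse = List.ofFn φ :=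
      ⟨fun i => C.reverse.get (i.cast (by simp [h])), by
        refine List.ext_get (by simp [h]) fun n _ _ => by simp⟩
    obtain ⟨i, rfl⟩ := List.mem_iff_get.mp hD
    have hdet := quasiFree_det hω hF φ D.get
    rw [← hφ, List.reverse_reverse, List.ofFn_get] at hdet
    rw [hdet]
    refine Matrix.det_eq_zero_of_row_eq_zero i fun k => ?_
    refine if_neg fun hk => hC ?_
    rw [← List.mem_reverse, hφ, hk]
    exact List.mem_ofFn.mpr ⟨k, rfl⟩
  · exact quasiFree_eq_zero_of_length hω hF h

lemma quasiFree_eq_zero_of_notMem_right {C D : List ℤ} {t : ℤ} (hC : t ∈ C) (hD : t ∉ D) :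
    F ((C.map createAt).prod * (D.map annihAt).prod) = 0 := by
  by_cases h : C.length = D.length
  · obtain ⟨ψ, rfl⟩ : ∃ ψ : Fin C.reverse.length → ℤ, D = List.ofFn ψ :=
      ⟨fun i => D.get (i.cast (by simp [h])), by
        refine List.ext_get (by simp [h]) fun n _ _ => by simp⟩
    obtain ⟨i, rfl⟩ := List.mem_iff_get.mp (List.mem_reverse.mpr hC)
    have hdet := quasiFree_det hω hF C.reverse.get ψ
    rw [List.ofFn_get, List.reverse_reverse] at hdet
    rw [hdet]
    refine Matrix.det_eq_zero_of_column_eq_zero i fun k => ?_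
    refine if_neg fun hk => hD ?_
    rw [← hk]
    exact List.mem_ofFn.mpr ⟨k, rfl⟩
  · exact quasiFree_eq_zero_of_length hω hF h

/-- The row of the new annihilator is `(σ, 0, …, 0)`, as `t` matches no other creator; expansion
along it gives the factor `σ`. -/
lemma quasiFree_insert_number {C D : List ℤ} {t : ℤ} (hC : t ∉ C) :
    F (((C ++ [t]).map createAt).prod * ((t :: D).map annihAt).prod) =
      σ * F ((C.map createAt).prod * (D.map annihAt).prod) := by
  by_cases h : C.length = D.length
  · obtain ⟨φ, hφ⟩ : ∃ φ : Fin D.length → ℤ, C.reverse = List.ofFn φ :=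
      ⟨fun i => C.reverse.get (i.cast (by simp [h])), by
        refine List.ext_get (by simp [h]) fun n _ _ => by simp⟩
    have hdet := quasiFree_det hω hF φ D.get
    have hdet' := quasiFree_det hω hF (Fin.cons t φ : Fin (D.length + 1) → ℤ)
      (Fin.cons t D.get : Fin (D.length + 1) → ℤ)
    rw [List.ofFn_cons, List.ofFn_cons, ← hφ, List.ofFn_get, List.reverse_cons,
      List.reverse_reverse] at hdet'
    rw [← hφ, List.reverse_reverse, List.ofFn_get] at hdet
    rw [hdet, hdet', Matrix.det_succ_row_zero, Finset.sum_eq_single 0]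
    · simp [Matrix.submatrix]
    · intro k _ hk
      obtain ⟨l, rfl⟩ := Fin.exists_succ_eq.mpr hk
      have : t ≠ φ l := fun hl => hC (by
        rw [← List.mem_reverse, hφ, hl]
        exact List.mem_ofFn.mpr ⟨l, rfl⟩)
      simp [this]
    · simp
  · rw [quasiFree_eq_zero_of_length hω hF h, quasiFree_eq_zero_of_length hω hF (by simpa using h),
      mul_zero]

/-- `Y` only involves sites below `n`, so after normal ordering the annihilator at `n` meets no
creator at `n`. -/
lemma quasiFree_mul_annihAt {n : ℤ} {Y : Fock ℤ →L[ℂ] Fock ℤ} (hY : Y ∈ locAlg n) :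
    F (Y * annihAt n) = 0 := by
  have hY' := mem_normalSpan_of_mem_locAlg hY
  clear hY
  induction hY' using Submodule.span_induction with
  | mem Z hZ =>
    obtain ⟨C, D, hC, hD, rfl⟩ := hZ
    have := quasiFree_eq_zero_of_notMem_left hω hF (C := C) (D := D ++ [n]) (t := n)
      (fun h => (hC n h).false) (by simp)
    simpa [mul_assoc] using this
  | zero => simp
  | add x y _ _ hx hy => rw [add_mul, map_add, hx, hy, add_zero]
  | smul c x _ hx => rw [smul_mul_assoc, map_smul, hx, smul_zero]

lemma quasiFree_mul_createAt {n : ℤ} {Y : Fock ℤ →L[ℂ] Fock ℤ} (hY : Y ∈ locAlg n) :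
    F (Y * createAt n) = 0 := by
  have hY' := mem_normalSpan_of_mem_locAlg hY
  clear hY
  induction hY' using Submodule.span_induction with
  | mem Z hZ =>
    obtain ⟨C, D, hC, hD, rfl⟩ := hZ
    have hn : n ∉ D := fun h => (hD n h).false
    have := quasiFree_eq_zero_of_notMem_right hω hF (C := C ++ [n]) (D := D) (t := n)
      (by simp) hn
    rw [mul_assoc, prod_annihAt_mul_createAt hn, mul_smul_comm, map_smul, ← mul_assoc]
    simp only [List.map_append, List.map_cons, List.map_nil, List.prod_append, List.prod_cons,
      List.prod_nil, mul_one] at this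
    rw [this, smul_zero]
  | zero => simp
  | add x y _ _ hx hy => rw [add_mul, map_add, hx, hy, add_zero]
  | smul c x _ hx => rw [smul_mul_assoc, map_smul, hx, smul_zero]

/-- The number operator at `n` is even, so it commutes with the annihilators at other sites and can
be moved between creators and annihilators, where `quasiFree_insert_number` applies. -/
lemma quasiFree_mul_number {n : ℤ} {Y : Fock ℤ →L[ℂ] Fock ℤ} (hY : Y ∈ locAlg n) :
    F (Y * (createAt n * annihAt n)) = σ * F Y := by
  have hY' := mem_normalSpan_of_mem_locAlg hY
  clear hY
  induction hY' using Submodule.span_induction with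
  | mem Z hZ =>
    obtain ⟨C, D, hC, hD, rfl⟩ := hZ
    have hcomm : Commute (createAt n * annihAt n) ((D.map annihAt).prod) := by
      refine Commute.list_prod_right _ _ fun x hx => ?_
      obtain ⟨j, hj, rfl⟩ := List.mem_map.mp hx
      have hjn : j ≠ n := (hD j hj).ne
      rw [Commute, SemiconjBy, mul_assoc, annihAt_mul_annihAt, ← mul_assoc (annihAt j),
        annihAt_mul_createAt, if_neg hjn, zero_sub, mul_neg, neg_mul, mul_assoc]
    have := quasiFree_insert_number hω hF (C := C) (D := D) (t := n) fun h => (hC n h).false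
    rw [mul_assoc, ← hcomm.eq, ← this]
    simp [mul_assoc]
  | zero => simp
  | add x y _ _ hx hy => rw [add_mul, map_add, hx, hy, map_add, mul_add]
  | smul c x _ hx =>
    rw [smul_mul_assoc, map_smul, hx, map_smul, smul_eq_mul, smul_eq_mul, mul_left_comm]

end QuasiFree

/-! ### One time step -/

section Step

variable {d : ℕ}

/-- The operators on the joint system all of whose blocks lie in a given subalgebra. -/
def blockAlg (d : ℕ) (L : StarSubalgebra ℂ (Fock ℤ →L[ℂ] Fock ℤ)) :
    StarSubalgebra ℂ (Joint d →L[ℂ] Joint d) where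
  carrier := {X | ∀ I J, block I J X ∈ L}
  mul_mem' := fun {X Y} hX hY I J => by
    rw [block_mul]
    exact sum_mem fun K _ => mul_mem (hX I K) (hY K J)
  add_mem' := fun {X Y} hX hY I J => by
    rw [block_add]
    exact add_mem (hX I J) (hY I J)
  algebraMap_mem' := fun r I J => by
    rw [Algebra.algebraMap_eq_smul_one, block_smul, block_one]
    refine L.smul_mem ?_ r
    split_ifs
    · exact one_mem _
    · exact zero_mem _
  star_mem' := fun {X} hX I J => by
    rw [block_star]
    exact star_mem (hX J I)

lemma joint_star_add (X Y : Joint d →L[ℂ] Joint d) : star (X + Y) = star X + star Y := by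
  refine ext_block fun I J => ?_
  simp only [block_add, block_star, star_add]

lemma joint_star_smul (c : ℂ) (X : Joint d →L[ℂ] Joint d) : star (c • X) = star c • star X := by
  refine ext_block fun I J => ?_
  simp only [block_smul, block_star, star_smul]

lemma tens_mem_blockAlg {L : StarSubalgebra ℂ (Fock ℤ →L[ℂ] Fock ℤ)}
    {A : Fock ℤ →L[ℂ] Fock ℤ} (hA : A ∈ L) (C : Fock (Fin d) →L[ℂ] Fock (Fin d)) :
    tens A C ∈ blockAlg d L := fun I J => by
  rw [block_tens]
  exact L.smul_mem hA _

/-! ### Locality of evolved sample observables -/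

variable [NeZero d]

lemma coupling_mem_blockAlg (α : ℝ) {n : ℤ} (hn : 0 < n) :
    coupling d α ∈ blockAlg d (locAlg n) := by
  have h1 := createAt_mem_locAlg hn
  have h2 := annihAt_mem_locAlg hn
  rw [coupling_eq]
  refine sub_mem (add_mem (one_mem _) (StarSubalgebra.smul_mem _ (add_mem ?_ ?_) _))
    (StarSubalgebra.smul_mem _ (add_mem ?_ ?_) _)
  · exact tens_mem_blockAlg (mul_mem h1 h2) _
  · exact tens_mem_blockAlg (mul_mem h2 h1) _
  · exact tens_mem_blockAlg h1 _
  · exact tens_mem_blockAlg h2 _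

/-- The shift raises every site by one, and the coupling only adds site `0`, which lies below `n +
1`. -/
lemma step_mem_blockAlg (W : Matrix (Fin d) (Fin d) ℂ) (α : ℝ) {n : ℤ} (hn : 0 ≤ n)
    {X : Joint d →L[ℂ] Joint d} (hX : X ∈ blockAlg d (locAlg n)) :
    star (stepOp W α) * X * stepOp W α ∈ blockAlg d (locAlg (n + 1)) := by
  have hG : star (tens shiftFock (secondQuant W)) * X * tens shiftFock (secondQuant W) ∈
      blockAlg d (locAlg (n + 1)) := by
    intro I J
    rw [block_mul]
    refine sum_mem fun K _ => ?_
    rw [block_mul, Finset.sum_mul]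
    refine sum_mem fun L _ => ?_
    rw [block_star, block_tens, block_tens, star_smul, mul_smul_comm, smul_mul_assoc,
      smul_mul_assoc]
    exact StarSubalgebra.smul_mem _
      (StarSubalgebra.smul_mem _ (shift_conj_mem_locAlg (hX L K)) _) _
  have hK : coupling d α ∈ blockAlg d (locAlg (n + 1)) := coupling_mem_blockAlg α (by omega)
  have : star (stepOp W α) * X * stepOp W α = star (coupling d α) *
      (star (tens shiftFock (secondQuant W)) * X * tens shiftFock (secondQuant W)) *
      coupling d α := by
    rw [stepOp, star_mul]
    simp only [mul_assoc]
  rw [this]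
  exact mul_mem (mul_mem (star_mem hK) hG) hK

/-- This leaves site `t` untouched, which makes it independent of the evolved observable in the
reservoir state. -/
lemma evolve_mem_blockAlg (W : Matrix (Fin d) (Fin d) ℂ) (α : ℝ) (t : ℕ)
    (A : Fock (Fin d) →L[ℂ] Fock (Fin d)) :
    star (stepOp W α ^ t) * tens 1 A * stepOp W α ^ t ∈ blockAlg d (locAlg t) := by
  induction t with
  | zero => simpa using tens_mem_blockAlg (one_mem _) A
  | succ t ih =>
    have := step_mem_blockAlg W α (by positivity) ih
    rw [pow_succ, star_mul]
    push_cast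
    simpa only [mul_assoc] using this

/-! The dressed reservoir operators `b_j ⊗ (-1)^N` are shifted by the evolution. -/

lemma commute_coupling {X : Joint d →L[ℂ] Joint d} (h : Commute X (interaction d)) (α : ℝ) :
    Commute X (coupling d α) := by
  rw [coupling, create_basisOne, create_basisOne, annih_basisOne, annih_basisOne,
    ← interaction]
  exact (h.smul_right _).exp_right

/-- In the ungraded tensor product `b_j* ⊗ 1` anticommutes with the interaction. The parity
anticommutes with `a₀` and `a₀*` and supplies the compensating sign. -/
lemma commute_dressed_createAt {j : ℤ} (hj : j ≠ 0) :
    Commute (tens (createAt j) (parity d)) (interaction d) := by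
  have h : createAt j * annihAt 0 = -(annihAt 0 * createAt j) := by
    rw [annihAt_mul_createAt, if_neg hj.symm, zero_sub, neg_neg]
  rw [Commute, SemiconjBy, interaction, mul_add, add_mul, tens_mul, tens_mul, tens_mul, tens_mul,
    parity_mul_annihAt, parity_mul_createAt, createAt_mul_createAt, h]
  simp only [tens_neg_left, tens_neg_right, neg_neg]

lemma commute_dressed_annihAt {j : ℤ} (hj : j ≠ 0) :
    Commute (tens (annihAt j) (parity d)) (interaction d) := by
  have h : annihAt j * createAt 0 = -(createAt 0 * annihAt j) := by
    rw [annihAt_mul_createAt, if_neg hj, zero_sub]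
  rw [Commute, SemiconjBy, interaction, mul_add, add_mul, tens_mul, tens_mul, tens_mul, tens_mul,
    parity_mul_annihAt, parity_mul_createAt, annihAt_mul_annihAt, h]
  simp only [tens_neg_left, tens_neg_right, neg_neg]

/-- In each step the operator first passes the shift, which raises its site by one. The new site is
at least `1`, so the operator then commutes with the coupling. -/
lemma dressed_createAt_mul_pow (W : Matrix (Fin d) (Fin d) ℂ) (α : ℝ) (t : ℕ) :
    tens (createAt 0) (parity d) * stepOp W α ^ t =
      stepOp W α ^ t * tens (createAt (t : ℤ)) (parity d) := by
  induction t with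
  | zero => simp
  | succ t ih =>
    have hj : (t : ℤ) + 1 ≠ 0 := by positivity
    rw [pow_succ, ← mul_assoc, ih, mul_assoc, mul_assoc, Nat.cast_succ]
    refine congrArg (stepOp W α ^ t * ·) ?_
    rw [stepOp, ← mul_assoc, tens_mul, createAt_mul_shiftFock, parity_mul_secondQuant, ← tens_mul,
      mul_assoc, (commute_coupling (commute_dressed_createAt hj) α).eq, ← mul_assoc]

lemma dressed_annihAt_mul_pow (W : Matrix (Fin d) (Fin d) ℂ) (α : ℝ) (t : ℕ) :
    tens (annihAt 0) (parity d) * stepOp W α ^ t =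
      stepOp W α ^ t * tens (annihAt (t : ℤ)) (parity d) := by
  induction t with
  | zero => simp
  | succ t ih =>
    have hj : (t : ℤ) + 1 ≠ 0 := by positivity
    rw [pow_succ, ← mul_assoc, ih, mul_assoc, mul_assoc, Nat.cast_succ]
    refine congrArg (stepOp W α ^ t * ·) ?_
    rw [stepOp, ← mul_assoc, tens_mul, annihAt_mul_shiftFock, parity_mul_secondQuant, ← tens_mul,
      mul_assoc, (commute_coupling (commute_dressed_annihAt hj) α).eq, ← mul_assoc]

/-- The two parities multiply to `1`, so the even operator needs no dressing. -/
lemma number_mul_pow (W : Matrix (Fin d) (Fin d) ℂ) (α : ℝ) (t : ℕ) :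
    tens (createAt 0 * annihAt 0) 1 * stepOp W α ^ t =
      stepOp W α ^ t * tens (createAt (t : ℤ) * annihAt (t : ℤ)) 1 := by
  rw [← parity_mul_self, ← tens_mul, ← tens_mul, mul_assoc, dressed_annihAt_mul_pow, ← mul_assoc,
    dressed_createAt_mul_pow, mul_assoc]

/-- The Heisenberg evolution of a sample observable under the coupling. -/
lemma star_coupling_mul_mul_coupling (α : ℝ) (A : Fock (Fin d) →L[ℂ] Fock (Fin d)) :
    ∃ C D : Fock (Fin d) →L[ℂ] Fock (Fin d),
      star (coupling d α) * tens 1 A * coupling d α =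
        tens (createAt 0 * annihAt 0)
            ((numAt d + (Real.cos α : ℂ) • holeAt d) * A *
                (numAt d + (Real.cos α : ℂ) • holeAt d) +
              (Real.sin α : ℂ) ^ 2 • (annihAt 0 * A * createAt 0)) +
          tens (annihAt 0 * createAt 0)
            (((Real.cos α : ℂ) • numAt d + holeAt d) * A *
                ((Real.cos α : ℂ) • numAt d + holeAt d) +
              (Real.sin α : ℂ) ^ 2 • (createAt 0 * A * annihAt 0)) +
          tens (createAt 0) C + tens (annihAt 0) D := by
  obtain ⟨c, hc⟩ : ∃ c : ℂ, c = (Real.cos α : ℂ) := ⟨_, rfl⟩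
  obtain ⟨s, hs⟩ : ∃ s : ℂ, s = (Real.sin α : ℂ) := ⟨_, rfl⟩
  have hcs : star c = c := by rw [hc]; exact Complex.conj_ofReal _
  have hss : star s = s := by rw [hs]; exact Complex.conj_ofReal _
  obtain ⟨P, hP⟩ : ∃ P, P = numAt d + c • holeAt d := ⟨_, rfl⟩
  obtain ⟨Q, hQ⟩ : ∃ Q, Q = c • numAt d + holeAt d := ⟨_, rfl⟩
  -- Splitting the identity over the occupied and empty states of the reservoir mode and of the
  -- sample mode turns the coupling into a sum over the reservoir factors `b₀* b₀`, `b₀ b₀*`, `b₀*`,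
  -- `b₀`.
  have hone : (1 : Joint d →L[ℂ] Joint d) =
      tens (createAt 0 * annihAt 0) (numAt d + holeAt d) +
        tens (annihAt 0 * createAt 0) (numAt d + holeAt d) := by
    rw [← tens_add_left, numAt, holeAt, add_comm (createAt _ * _), annihAt_mul_createAt_add,
      add_comm (createAt _ * _), annihAt_mul_createAt_add, if_pos rfl, if_pos rfl, tens_one_one]
  have hK : coupling d α = tens (createAt 0 * annihAt 0) P + tens (annihAt 0 * createAt 0) Q +
      (-(Complex.I * s)) • (tens (createAt 0) (annihAt 0) + tens (annihAt 0) (createAt 0)) := by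
    rw [coupling_eq, hone, interaction, hP, hQ, ← hc, ← hs]
    simp only [tens_add_right, tens_smul_right]
    module
  have hPs : star P = P := by
    rw [hP, numAt, holeAt]
    simp only [star_add, star_mul, star_smul, star_createAt, star_annihAt, hcs]
  have hQs : star Q = Q := by
    rw [hQ, numAt, holeAt]
    simp only [star_add, star_mul, star_smul, star_createAt, star_annihAt, hcs]
  have hK' : star (coupling d α) =
      tens (createAt 0 * annihAt 0) P + tens (annihAt 0 * createAt 0) Q +
      (Complex.I * s) • (tens (createAt 0) (annihAt 0) + tens (annihAt 0) (createAt 0)) := by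
    have hIs : star (-(Complex.I * s)) = Complex.I * s := by
      rw [star_neg, star_mul, hss]
      simp [mul_comm]
    rw [hK]
    simp only [joint_star_add, joint_star_smul, tens_star, star_mul, star_createAt, star_annihAt, hPs, hQs,
      hIs, add_comm (tens (annihAt 0) (createAt 0))]
  have hI : Complex.I * s * -(Complex.I * s) = s ^ 2 := by
    linear_combination (-s ^ 2) * Complex.I_sq
  have e1 : ∀ X : Fock ℤ →L[ℂ] Fock ℤ, createAt (0 : ℤ) * (createAt 0 * X) = 0 := fun X => by
    rw [← mul_assoc, createAt_mul_self, zero_mul]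
  have e2 : ∀ X : Fock ℤ →L[ℂ] Fock ℤ, annihAt (0 : ℤ) * (annihAt 0 * X) = 0 := fun X => by
    rw [← mul_assoc, annihAt_mul_self, zero_mul]
  have e3 : createAt (0 : ℤ) * (annihAt 0 * createAt 0) = createAt 0 := by
    rw [← mul_assoc, createAt_annihAt_createAt]
  have e4 : annihAt (0 : ℤ) * (createAt 0 * annihAt 0) = annihAt 0 := by
    rw [← mul_assoc, annihAt_createAt_annihAt]
  -- These are the cross terms of the `sin α` part with the diagonal part. Their exact form is
  -- irrelevant later, because odd reservoir factors have expectation zero.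
  refine ⟨(Complex.I * s) • (annihAt 0 * A * Q) - (Complex.I * s) • (P * A * annihAt 0),
    (Complex.I * s) • (createAt 0 * A * P) - (Complex.I * s) • (Q * A * createAt 0), ?_⟩
  rw [hK', hK, ← hc, ← hs, ← hP, ← hQ, ← hI]
  simp only [add_mul, mul_add, smul_mul_assoc, mul_smul_comm, tens_mul, mul_one,
    mul_assoc, e1, e2, e3, e4, createAt_mul_self, annihAt_mul_self, mul_zero,
    tens_zero_left, smul_zero, add_zero, zero_add, tens_add_right, tens_smul_right,
    sub_eq_add_neg, tens_neg_right, smul_add]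
  module

end Step

/-! ### The evolution of the sample state -/

section SampleState

variable {d : ℕ}

/-- The functional `F ⊗ ρ` on all operators of the joint system. -/
def prodFunctional (F : (Fock ℤ →L[ℂ] Fock ℤ) →ₗ[ℂ] ℂ) (ρ : Fock (Fin d) →L[ℂ] Fock (Fin d)) :
    (Joint d →L[ℂ] Joint d) →ₗ[ℂ] ℂ :=
  ∑ I, ∑ J, ⟪basisVec J, ρ (basisVec I)⟫_ℂ • (F ∘ₗ blockLinear I J)

lemma prodFunctional_apply (F : (Fock ℤ →L[ℂ] Fock ℤ) →ₗ[ℂ] ℂ)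
    (ρ : Fock (Fin d) →L[ℂ] Fock (Fin d)) (X : Joint d →L[ℂ] Joint d) :
    prodFunctional F ρ X =
      ∑ I, ∑ J, ⟪basisVec J, ρ (basisVec I)⟫_ℂ * F (block I J X) := by
  simp only [prodFunctional, LinearMap.sum_apply]
  rfl

lemma prodFunctional_mul_tens {F : (Fock ℤ →L[ℂ] Fock ℤ) →ₗ[ℂ] ℂ}
    (ρ : Fock (Fin d) →L[ℂ] Fock (Fin d)) {L : StarSubalgebra ℂ (Fock ℤ →L[ℂ] Fock ℤ)}
    {B : Fock ℤ →L[ℂ] Fock ℤ} {z : ℂ} (hB : ∀ Y ∈ L, F (Y * B) = z * F Y)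
    {Z : Joint d →L[ℂ] Joint d} (hZ : Z ∈ blockAlg d L) (C : Fock (Fin d) →L[ℂ] Fock (Fin d)) :
    prodFunctional F ρ (Z * tens B C) = z * prodFunctional F ρ (Z * tens 1 C) := by
  simp only [prodFunctional_apply, Finset.mul_sum, block_mul, block_tens, map_sum,
    mul_smul_comm, map_smul, smul_eq_mul, hB _ (hZ _ _), mul_one]
  refine Finset.sum_congr rfl fun I _ => Finset.sum_congr rfl fun J _ =>
    Finset.sum_congr rfl fun K _ => ?_
  ring

variable [NeZero d]

/-- The state of the sample at time `t` as a linear functional. -/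
def sampleFunctional (F : (Fock ℤ →L[ℂ] Fock ℤ) →ₗ[ℂ] ℂ) (ρ : Fock (Fin d) →L[ℂ] Fock (Fin d))
    (W : Matrix (Fin d) (Fin d) ℂ) (α : ℝ) (t : ℕ) :
    (Fock (Fin d) →L[ℂ] Fock (Fin d)) →ₗ[ℂ] ℂ :=
  prodFunctional F ρ ∘ₗ LinearMap.mulRight ℂ (stepOp W α ^ t) ∘ₗ
    LinearMap.mulLeft ℂ (star (stepOp W α ^ t)) ∘ₗ tensLinear 1

lemma sampleFunctional_apply (F : (Fock ℤ →L[ℂ] Fock ℤ) →ₗ[ℂ] ℂ)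
    (ρ : Fock (Fin d) →L[ℂ] Fock (Fin d)) (W : Matrix (Fin d) (Fin d) ℂ) (α : ℝ) (t : ℕ)
    (A : Fock (Fin d) →L[ℂ] Fock (Fin d)) : sampleFunctional F ρ W α t A =
      prodFunctional F ρ (star (stepOp W α ^ t) * tens 1 A * stepOp W α ^ t) := rfl

variable {ω : resAlg →ₗ[ℂ] ℂ} {σ : ℝ} {F : (Fock ℤ →L[ℂ] Fock ℤ) →ₗ[ℂ] ℂ}

lemma sampleState_eq (hF : ∀ X : resAlg, F X = ω X) (ρ : Fock (Fin d) →L[ℂ] Fock (Fin d))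
    (W : Matrix (Fin d) (Fin d) ℂ) (α : ℝ) (t : ℕ) :
    sampleState ω ρ W α t = ⇑(sampleFunctional F ρ W α t) := by
  funext A
  rw [sampleFunctional_apply, prodFunctional_apply]
  rw [sampleState, prodState]
  refine Finset.sum_congr rfl fun I _ => Finset.sum_congr rfl fun J _ => ?_
  rw [← hF]
  rfl

lemma sampleFunctional_zero (hF1 : F 1 = 1) (ρ : Fock (Fin d) →L[ℂ] Fock (Fin d))
    (W : Matrix (Fin d) (Fin d) ℂ) (α : ℝ) (A : Fock (Fin d) →L[ℂ] Fock (Fin d)) :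
    sampleFunctional F ρ W α 0 A = fockTrace (ρ * A) := by
  have h : star (stepOp W α ^ 0) * tens 1 A * stepOp W α ^ 0 = tens 1 A := by simp
  rw [sampleFunctional_apply, h, prodFunctional_apply, Finset.sum_comm]
  simp only [block_tens, map_smul F, hF1, smul_eq_mul, mul_one, fockTrace, inner_mul_basisVec]

/-- The step next to the observable is carried out explicitly; the remaining `t` steps move its
reservoir factors to site `t`, where the quasi-free state averages them independently of the rest.
-/
lemma sampleFunctional_succ
    (hω : IsQuasiFree ω ((σ : ℂ) • ContinuousLinearMap.id ℂ (OneParticle ℤ)))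
    (hF : ∀ X : resAlg, F X = ω X) (ρ : Fock (Fin d) →L[ℂ] Fock (Fin d))
    {W : Matrix (Fin d) (Fin d) ℂ} (hW : W ∈ Matrix.unitaryGroup (Fin d) ℂ) (α : ℝ) (t : ℕ)
    {A A' : Fock (Fin d) →L[ℂ] Fock (Fin d)} (hA : A * secondQuant W = secondQuant W * A') :
    sampleFunctional F ρ W α (t + 1) A = sampleFunctional F ρ W α t
      ((σ : ℂ) • ((numAt d + (Real.cos α : ℂ) • holeAt d) * A' *
                (numAt d + (Real.cos α : ℂ) • holeAt d) +
              (Real.sin α : ℂ) ^ 2 • (annihAt 0 * A' * createAt 0)) +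
        (1 - σ : ℂ) • (((Real.cos α : ℂ) • numAt d + holeAt d) * A' *
                ((Real.cos α : ℂ) • numAt d + holeAt d) +
              (Real.sin α : ℂ) ^ 2 • (createAt 0 * A' * annihAt 0))) := by
  set U := stepOp W α with hU
  have hstep : star U * tens 1 A * U = star (coupling d α) * tens 1 A' * coupling d α := by
    rw [hU, stepOp, star_mul, tens_star]
    calc star (coupling d α) * tens (star shiftFock) (star (secondQuant W)) * tens 1 A *
          (tens shiftFock (secondQuant W) * coupling d α)
        = star (coupling d α) * (tens (star shiftFock) (star (secondQuant W)) *
            (tens 1 A * tens shiftFock (secondQuant W))) * coupling d α := by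
          simp only [mul_assoc]
      _ = star (coupling d α) * tens 1 A' * coupling d α := by
          rw [tens_mul, tens_mul, one_mul, star_shiftFock_mul, hA, ← mul_assoc,
            star_secondQuant_mul hW, one_mul]
  have hloc := fun C => evolve_mem_blockAlg W α t C
  -- Writing `C = (C * parity d) * parity d` splits off a dressed reservoir operator, which then
  -- passes through `U ^ t` to the right end.
  have hzero : ∀ B : Fock ℤ →L[ℂ] Fock ℤ, ∀ B' : Fock ℤ →L[ℂ] Fock ℤ,
      tens B (parity d) * U ^ t = U ^ t * tens B' (parity d) →
      (∀ Y ∈ locAlg t, F (Y * B') = 0) → ∀ C,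
      prodFunctional F ρ (star (U ^ t) * tens B C * U ^ t) = 0 := by
    intro B B' hBU hB C
    have h1 : star (U ^ t) * tens B C * U ^ t =
        star (U ^ t) * tens 1 (C * parity d) * U ^ t * tens B' (parity d) := by
      rw [mul_assoc _ (U ^ t), ← hBU, mul_assoc, mul_assoc, ← mul_assoc (tens 1 _), tens_mul,
        one_mul, mul_assoc C, parity_mul_self, mul_one]
    rw [h1, prodFunctional_mul_tens (z := 0) ρ (fun Y hY => by rw [hB Y hY, zero_mul]) (hloc _),
      zero_mul]
  have hc := hzero _ _ (dressed_createAt_mul_pow W α t) fun Y hY =>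
    quasiFree_mul_createAt hω hF hY
  have ha := hzero _ _ (dressed_annihAt_mul_pow W α t) fun Y hY =>
    quasiFree_mul_annihAt hω hF hY
  have hn : ∀ C, prodFunctional F ρ (star (U ^ t) * tens (createAt 0 * annihAt 0) C * U ^ t) =
      σ * sampleFunctional F ρ W α t C := by
    intro C
    have h1 : star (U ^ t) * tens (createAt 0 * annihAt 0) C * U ^ t =
        star (U ^ t) * tens 1 C * U ^ t * tens (createAt (t : ℤ) * annihAt (t : ℤ)) 1 := by
      rw [mul_assoc _ (U ^ t), ← number_mul_pow, mul_assoc, mul_assoc, ← mul_assoc (tens 1 _),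
        tens_mul, one_mul, mul_one]
    rw [h1, prodFunctional_mul_tens ρ (fun Y hY => quasiFree_mul_number hω hF hY) (hloc _),
      tens_one_one, mul_one]
    rfl
  have hm : ∀ C, prodFunctional F ρ (star (U ^ t) * tens (annihAt 0 * createAt 0) C * U ^ t) =
      (1 - σ) * sampleFunctional F ρ W α t C := by
    intro C
    have h1 : tens (annihAt 0 * createAt 0) C =
        tens 1 C + (-1 : ℂ) • tens (createAt 0 * annihAt 0) C := by
      rw [← tens_smul_left, ← tens_add_left, annihAt_mul_createAt, if_pos rfl, neg_one_smul,
        sub_eq_add_neg]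
    rw [h1, mul_add, add_mul, map_add, mul_smul_comm, smul_mul_assoc, map_smul, hn,
      ← sampleFunctional_apply, smul_eq_mul]
    ring
  obtain ⟨C, D, hCD⟩ := star_coupling_mul_mul_coupling α A'
  -- The newly split off factor `U` stands next to the observable, so that the coupling is resolved
  -- before the other `t` steps act.
  have hsucc : star (U ^ (t + 1)) * tens 1 A * U ^ (t + 1) =
      star (U ^ t) * (star U * tens 1 A * U) * U ^ t := by
    rw [pow_succ', star_mul]
    simp only [mul_assoc]
  rw [sampleFunctional_apply, hsucc, hstep, hCD]
  simp only [mul_add, add_mul _ _ (U ^ t), map_add (prodFunctional F ρ), hn, hm, hc, ha, add_zero,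
    map_add (sampleFunctional F ρ W α t), map_smul (sampleFunctional F ρ W α t), smul_eq_mul]

end SampleState

/-! ### The action of one step on two-body observables -/

section TwoBodyStep

variable {d : ℕ} [NeZero d]

/-- The component of `u` orthogonal to `e₀`. -/
def perp (u : Fin d → ℂ) : Fin d → ℂ := fun l => if l = 0 then 0 else u l

/-- The vector `u` with its component along `e₀` multiplied by `c`. -/
def scaleZero (c : ℂ) (u : Fin d → ℂ) : Fin d → ℂ := fun l => if l = 0 then c * u l else u l

lemma createVec_eq (u : Fin d → ℂ) : createVec u = u 0 • createAt 0 + createVec (perp u) := by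
  rw [createVec, createVec, ← Finset.add_sum_erase _ _ (Finset.mem_univ (0 : Fin d)),
    ← Finset.add_sum_erase Finset.univ (fun l => perp u l • createAt l)
      (Finset.mem_univ (0 : Fin d))]
  rw [perp, if_pos rfl, zero_smul, zero_add]
  congr 1
  refine Finset.sum_congr rfl fun l hl => ?_
  rw [perp, if_neg (Finset.ne_of_mem_erase hl)]

lemma annihVec_eq (u : Fin d → ℂ) :
    annihVec u = star (u 0) • annihAt 0 + annihVec (perp u) := by
  rw [← star_createVec, createVec_eq, star_add, star_smul, star_createAt, star_createVec]

lemma perp_scaleZero (c : ℂ) (u : Fin d → ℂ) : perp (scaleZero c u) = perp u := by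
  funext l
  simp only [perp, scaleZero]
  split_ifs <;> rfl

lemma createVec_scaleZero (c : ℂ) (u : Fin d → ℂ) :
    createVec (scaleZero c u) = (c * u 0) • createAt 0 + createVec (perp u) := by
  rw [createVec_eq, perp_scaleZero, scaleZero, if_pos rfl]

lemma annihVec_scaleZero (c : ℂ) (u : Fin d → ℂ) :
    annihVec (scaleZero c u) = star (c * u 0) • annihAt 0 + annihVec (perp u) := by
  rw [annihVec_eq, perp_scaleZero, scaleZero, if_pos rfl]

lemma createVec_perp_mul_createAt (u : Fin d → ℂ) :
    createVec (perp u) * createAt 0 = -(createAt 0 * createVec (perp u)) := by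
  simp only [createVec, Finset.sum_mul, Finset.mul_sum, smul_mul_assoc, mul_smul_comm,
    createAt_mul_createAt _ (0 : Fin d), smul_neg, Finset.sum_neg_distrib]

/-- The contraction with `a₀` is the `e₀` component, which `perp` removes. -/
lemma createVec_perp_mul_annihAt (u : Fin d → ℂ) :
    createVec (perp u) * annihAt 0 = -(annihAt 0 * createVec (perp u)) := by
  simp only [createVec, Finset.sum_mul, Finset.mul_sum, smul_mul_assoc, mul_smul_comm,
    ← Finset.sum_neg_distrib]
  refine Finset.sum_congr rfl fun l _ => ?_
  rcases eq_or_ne l 0 with rfl | h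
  · simp [perp]
  · rw [annihAt_mul_createAt, if_neg h.symm, zero_sub, smul_neg, neg_neg]

lemma annihVec_perp_mul_createAt (u : Fin d → ℂ) :
    annihVec (perp u) * createAt 0 = -(createAt 0 * annihVec (perp u)) := by
  have h := congrArg star (createVec_perp_mul_annihAt u)
  rw [star_neg, star_mul, star_mul, star_annihAt, star_createVec] at h
  rw [h, neg_neg]

lemma annihVec_perp_mul_annihAt (u : Fin d → ℂ) :
    annihVec (perp u) * annihAt 0 = -(annihAt 0 * annihVec (perp u)) := by
  have h := congrArg star (createVec_perp_mul_createAt u)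
  rw [star_neg, star_mul, star_mul, star_createAt, star_createVec] at h
  rw [h, neg_neg]

/-- The Heisenberg map of one step on products of two creation and two annihilation operators,
in an algebra with one fermionic mode `(a', a)` anticommuting with `U`, `V`, `X`, `Y`. -/
lemma coupling_average_eq {A : Type*} [Ring A] [Algebra ℂ A] {a' a U V X Y : A}
    (haa : a * a = 0) (haa' : a' * a' = 0) (hcar : a * a' = 1 - a' * a)
    (hU : U * a = -(a * U)) (hU' : U * a' = -(a' * U))
    (hV : V * a = -(a * V)) (hV' : V * a' = -(a' * V))
    (hX : X * a = -(a * X)) (hX' : X * a' = -(a' * X))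
    (hY : Y * a = -(a * Y)) (hY' : Y * a' = -(a' * Y))
    {c s2 : ℂ} (hcs : s2 = 1 - c ^ 2) (σ u v x y : ℂ) {Z : A}
    (hZ : Z = (u • a' + U) * (v • a' + V) * (x • a + X) * (y • a + Y)) :
    σ • ((a' * a + c • (a * a')) * Z * (a' * a + c • (a * a')) + s2 • (a * Z * a')) +
      (1 - σ) • ((c • (a' * a) + a * a') * Z * (c • (a' * a) + a * a') + s2 • (a' * Z * a)) =
    ((c * u) • a' + U) * ((c * v) • a' + V) * ((c * x) • a + X) * ((c * y) • a + Y) +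
      (σ * s2) • ((u • V - v • U) * (y • X - x • Y)) := by
  have l1 : ∀ T : A, a * (a * T) = 0 := fun T => by rw [← mul_assoc, haa, zero_mul]
  have l2 : ∀ T : A, a' * (a' * T) = 0 := fun T => by rw [← mul_assoc, haa', zero_mul]
  have l3 : ∀ T : A, a * (a' * T) = T - a' * (a * T) := fun T => by
    rw [← mul_assoc, hcar, sub_mul, one_mul, mul_assoc]
  have mv : ∀ {P Q : A}, P * Q = -(Q * P) → ∀ T : A, P * (Q * T) = -(Q * (P * T)) :=
    fun h T => by rw [← mul_assoc, h, neg_mul, mul_assoc]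
  have m1 := mv hU
  have m2 := mv hU'
  have m3 := mv hV
  have m4 := mv hV'
  have m5 := mv hX
  have m6 := mv hX'
  have m8 := mv hY'
  subst hcs
  rw [hZ]
  -- Every term is brought to a normal form with `a'`, then `a`, to the left of a word in `U`, `V`,
  -- `X`, `Y`. No relation among these four is needed, and the coefficients agree once `s2 = 1 - c ^
  -- 2`.
  simp only [add_mul, mul_add, sub_mul, mul_sub, smul_mul_assoc, mul_smul_comm, mul_assoc,
    mul_neg, neg_mul, neg_neg, hcar, haa', l1, l2, l3, hU, hU', hV, hX, hX', hY, hY',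
    m1, m2, m3, m4, m5, m6, m8, mul_zero, mul_one, one_mul, smul_zero, add_zero, zero_add, sub_zero,
    neg_zero]
  module

end TwoBodyStep

/-! ### Reduced density matrices -/

section Reduced

variable {d : ℕ}

/-- The kernel `f(a_{k₁}* a_{k₂}* a_{j₂} a_{j₁})` over all pairs of indices. -/
def twoBodyKernel (f : (Fock (Fin d) →L[ℂ] Fock (Fin d)) → ℂ) :
    Matrix (Fin d × Fin d) (Fin d × Fin d) ℂ :=
  Matrix.of fun j k => f (createAt k.1 * createAt k.2 * annihAt j.2 * annihAt j.1)

lemma twoBodyKernel_swap_left (f : (Fock (Fin d) →L[ℂ] Fock (Fin d)) →ₗ[ℂ] ℂ)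
    (j k : Fin d × Fin d) : twoBodyKernel f j.swap k = -twoBodyKernel f j k := by
  simp only [twoBodyKernel, Matrix.of_apply, Prod.fst_swap, Prod.snd_swap]
  rw [mul_assoc, annihAt_mul_annihAt, mul_neg, map_neg, mul_assoc _ (annihAt j.2)]

lemma twoBodyKernel_swap_right (f : (Fock (Fin d) →L[ℂ] Fock (Fin d)) →ₗ[ℂ] ℂ)
    (j k : Fin d × Fin d) : twoBodyKernel f j k.swap = -twoBodyKernel f j k := by
  simp only [twoBodyKernel, Matrix.of_apply, Prod.fst_swap, Prod.snd_swap]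
  rw [createAt_mul_createAt, neg_mul, neg_mul, map_neg]

lemma wedge_apply (l j : Fin d × Fin d) : wedge l j = ((Real.sqrt 2 : ℝ) : ℂ)⁻¹ *
    ((if j = l then 1 else 0) - if j = l.swap then 1 else 0) := by
  simp only [wedge, Pi.smul_apply, Pi.sub_apply, Pi.single_apply, smul_eq_mul]

lemma star_wedge (l : Fin d × Fin d) : star (wedge l) = wedge l := by
  funext j
  rw [Pi.star_apply, wedge_apply]
  have : star (((Real.sqrt 2 : ℝ) : ℂ)⁻¹) = ((Real.sqrt 2 : ℝ) : ℂ)⁻¹ := by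
    rw [star_inv₀]
    exact congrArg _ (Complex.conj_ofReal _)
  rw [star_mul, this, mul_comm, star_sub]
  congr 2 <;> split_ifs <;> simp

/-- An antisymmetric function is recovered from its values on increasing pairs. -/
lemma sum_mul_wedge (g : Fin d × Fin d → ℂ) (hg : ∀ j, g j.swap = -g j) (j : Fin d × Fin d) :
    ∑ l with l.1 < l.2, g l * wedge l j = ((Real.sqrt 2 : ℝ) : ℂ)⁻¹ * g j := by
  simp only [wedge_apply]
  rcases lt_trichotomy j.1 j.2 with h | h | h
  · rw [Finset.sum_eq_single j]
    · have : j ≠ j.swap := fun hj => h.ne (congrArg Prod.fst hj)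
      simp [this, mul_comm]
    · intro l hl hlj
      have h1 : j ≠ l.swap := fun hj => by
        subst hj
        exact lt_asymm h (Finset.mem_filter.mp hl).2
      simp [hlj.symm, h1]
    · intro hj
      simp [h] at hj
  · have hj : j.swap = j := Prod.ext h.symm h
    have h0 : g j = 0 := eq_zero_of_eq_neg (by rw [← hg, hj])
    rw [h0, mul_zero]
    refine Finset.sum_eq_zero fun l hl => ?_
    have hl := (Finset.mem_filter.mp hl).2
    have h1 : j ≠ l := fun hh => by subst hh; exact hl.ne h
    have h2 : j ≠ l.swap := fun hh => by subst hh; exact hl.ne h.symm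
    simp [h1, h2]
  · rw [Finset.sum_eq_single j.swap]
    · have : j ≠ j.swap := fun hj => h.ne' (congrArg Prod.fst hj)
      simp [this, mul_comm, hg]
    · intro l hl hlj
      have h1 : j ≠ l.swap := fun hj => hlj (by rw [hj, Prod.swap_swap])
      have h2 : j ≠ l := fun hj => by
        subst hj
        exact lt_asymm h (Finset.mem_filter.mp hl).2
      simp [h1, h2]
    · intro hj
      simp [h] at hj

/-- Each of the two wedge expansions contributes `1 / √2`. Antisymmetry of the kernel removes the
restriction to increasing pairs, so later entries can be compared without distinguishing orderings.
-/
lemma twoBody_eq (f : (Fock (Fin d) →L[ℂ] Fock (Fin d)) →ₗ[ℂ] ℂ) :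
    twoBody f = (1 / 2 : ℂ) • twoBodyKernel f := by
  ext j k
  have hs : ((Real.sqrt 2 : ℝ) : ℂ)⁻¹ * ((Real.sqrt 2 : ℝ) : ℂ)⁻¹ = 1 / 2 := by
    rw [← mul_inv, ← Complex.ofReal_mul, Real.mul_self_sqrt zero_le_two]
    norm_num
  calc twoBody f j k
      = ∑ l with l.1 < l.2, (∑ m with m.1 < m.2, twoBodyKernel f l m * wedge m k) * wedge l j := by
        rw [twoBody, Matrix.sum_apply]
        refine Finset.sum_congr rfl fun l _ => ?_
        rw [Matrix.sum_apply, Finset.sum_mul]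
        refine Finset.sum_congr rfl fun m _ => ?_
        rw [Matrix.smul_apply, Matrix.vecMulVec_apply, star_wedge, create_basisOne,
          create_basisOne, annih_basisOne, annih_basisOne, smul_eq_mul, mul_comm (wedge l j),
          ← mul_assoc]
        rfl
    _ = ∑ l with l.1 < l.2, (((Real.sqrt 2 : ℝ) : ℂ)⁻¹ * twoBodyKernel f l k) * wedge l j := by
        refine Finset.sum_congr rfl fun l _ => ?_
        rw [sum_mul_wedge _ fun m => twoBodyKernel_swap_right f l m]
    _ = ((1 / 2 : ℂ) • twoBodyKernel f) j k := by
        rw [sum_mul_wedge (fun l => ((Real.sqrt 2 : ℝ) : ℂ)⁻¹ * twoBodyKernel f l k)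
          fun l => by rw [twoBodyKernel_swap_left, mul_neg], ← mul_assoc, hs]
        rfl

/-! ### The antisymmetrizer and congruences of reduced density matrices -/

lemma antisymProj_mul_apply (G : Matrix (Fin d × Fin d) (Fin d × Fin d) ℂ)
    (j k : Fin d × Fin d) : (antisymProj d * G) j k = (1 / 2) * (G j k - G j.swap k) := by
  rw [antisymProj, smul_mul_assoc, sub_mul, one_mul, Matrix.smul_apply, Matrix.sub_apply,
    Matrix.mul_apply, Finset.sum_eq_single j.swap]
  · simp
  · intro l _ hl
    have : j ≠ l.swap := fun h => hl (by rw [h, Prod.swap_swap])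
    simp [this]
  · simp

lemma mul_antisymProj_apply (G : Matrix (Fin d × Fin d) (Fin d × Fin d) ℂ)
    (j k : Fin d × Fin d) : (G * antisymProj d) j k = (1 / 2) * (G j k - G j k.swap) := by
  rw [antisymProj, mul_smul_comm, mul_sub, mul_one, Matrix.smul_apply, Matrix.sub_apply,
    Matrix.mul_apply, Finset.sum_eq_single k.swap]
  · simp
  · intro l _ hl
    simp [hl]
  · simp

/-- The flip commutes with `A ⊗ A`. -/
lemma antisymProj_mul_kronecker (A : Matrix (Fin d) (Fin d) ℂ) :
    antisymProj d * (A ⊗ₖ A) = (A ⊗ₖ A) * antisymProj d := by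
  ext j k
  rw [antisymProj_mul_apply, mul_antisymProj_apply]
  simp only [Matrix.kroneckerMap_apply, Prod.fst_swap, Prod.snd_swap]
  ring

lemma antisymProj_mul_twoBody (f : (Fock (Fin d) →L[ℂ] Fock (Fin d)) →ₗ[ℂ] ℂ) :
    antisymProj d * twoBody f = twoBody f := by
  ext j k
  rw [antisymProj_mul_apply, twoBody_eq, Matrix.smul_apply, Matrix.smul_apply,
    twoBodyKernel_swap_left, smul_neg]
  ring

lemma twoBody_mul_antisymProj (f : (Fock (Fin d) →L[ℂ] Fock (Fin d)) →ₗ[ℂ] ℂ) :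
    twoBody f * antisymProj d = twoBody f := by
  ext j k
  rw [mul_antisymProj_apply, twoBody_eq, Matrix.smul_apply, Matrix.smul_apply,
    twoBodyKernel_swap_right, smul_neg]
  ring

/-- The index of the creator is the column index of the one-body matrix, so the bilinear expansion
is a congruence by `N`. -/
lemma map_create_annih (f : (Fock (Fin d) →L[ℂ] Fock (Fin d)) →ₗ[ℂ] ℂ)
    (N : Matrix (Fin d) (Fin d) ℂ) (j k : Fin d) :
    f ((createVec fun l => star (N k l)) * annihVec fun l => star (N j l)) =
      (N * oneBody f * N.conjTranspose) j k := by
  simp only [createVec, annihVec, Finset.sum_mul, Finset.mul_sum, map_sum, smul_mul_smul_comm,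
    map_smul, Matrix.mul_apply, Matrix.conjTranspose_apply, oneBody, Matrix.of_apply,
    create_basisOne, annih_basisOne, star_star, smul_eq_mul]
  rw [Finset.sum_comm]
  refine Finset.sum_congr rfl fun m _ => Finset.sum_congr rfl fun l _ => ?_
  ring

lemma map_create_create_annih_annih (f : (Fock (Fin d) →L[ℂ] Fock (Fin d)) →ₗ[ℂ] ℂ)
    (N : Matrix (Fin d) (Fin d) ℂ) (j k : Fin d × Fin d) :
    f ((createVec fun l => star (N k.1 l)) * (createVec fun l => star (N k.2 l)) *
        (annihVec fun l => star (N j.2 l)) * annihVec fun l => star (N j.1 l)) =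
      ((N ⊗ₖ N) * twoBodyKernel f * (N ⊗ₖ N).conjTranspose) j k := by
  simp only [createVec, annihVec, Finset.sum_mul, Finset.mul_sum, map_sum, smul_mul_smul_comm,
    map_smul, Matrix.mul_apply, Matrix.conjTranspose_apply, twoBodyKernel, Matrix.of_apply,
    star_star, smul_eq_mul, Matrix.kroneckerMap_apply, star_mul]
  have h : ∀ T : Fin d → Fin d → Fin d → Fin d → ℂ, ∑ x, ∑ y, ∑ z, ∑ w, T x y z w =
      ∑ p : Fin d × Fin d, ∑ q : Fin d × Fin d, T q.1 q.2 p.2 p.1 := fun T => by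
    trans ∑ q : Fin d × Fin d, ∑ p : Fin d × Fin d, T q.1 q.2 p.2 p.1
    · simp only [Fintype.sum_prod_type]
      exact Finset.sum_congr rfl fun x _ => Finset.sum_congr rfl fun y _ => Finset.sum_comm
    · exact Finset.sum_comm
  rw [h]
  refine Finset.sum_congr rfl fun p _ => Finset.sum_congr rfl fun q _ => ?_
  ring

variable [NeZero d]

/-- The projections commute with `𝕄 ⊗ 𝕄` and its adjoint and fix the two-body matrix, so all of them
are absorbed. -/
lemma matM2_mul_twoBody_mul (W : Matrix (Fin d) (Fin d) ℂ) (α : ℝ)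
    (f : (Fock (Fin d) →L[ℂ] Fock (Fin d)) →ₗ[ℂ] ℂ) :
    matM2 W α * twoBody f * matM2Star W α =
      (1 / 2 : ℂ) • ((matM W α ⊗ₖ matM W α) * twoBodyKernel f *
        (matM W α ⊗ₖ matM W α).conjTranspose) := by
  have h1 : matM2 W α * twoBody f = (matM W α ⊗ₖ matM W α) * twoBody f := by
    rw [matM2, antisymProj_mul_kronecker, mul_assoc, antisymProj_mul_twoBody, mul_assoc,
      antisymProj_mul_twoBody]
  have h2 : twoBody f * matM2Star W α =
      twoBody f * (matM W α ⊗ₖ matM W α).conjTranspose := by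
    rw [matM2Star, mul_assoc, ← antisymProj_mul_kronecker, ← mul_assoc, ← mul_assoc,
      twoBody_mul_antisymProj, twoBody_mul_antisymProj, Matrix.conjTranspose_kronecker]
  rw [h1, mul_assoc, h2, ← mul_assoc, twoBody_eq, mul_smul_comm, smul_mul_assoc]

lemma matB_apply (W : Matrix (Fin d) (Fin d) ℂ) (α σ : ℝ) (j k : Fin d) :
    matB W α σ j k = (σ : ℂ) * (Real.sin α : ℂ) ^ 2 * (W j 0 * star (W k 0)) := by
  rw [matB, mul_smul_comm, smul_mul_assoc, Matrix.smul_apply, proj0, Matrix.mul_apply,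
    Finset.sum_eq_single 0]
  · simp
  · intro l _ hl
    simp [Matrix.mul_single_apply_of_ne _ _ _ _ _ hl]
  · simp

lemma matM_apply (W : Matrix (Fin d) (Fin d) ℂ) (α : ℝ) (k : Fin d) :
    (fun l => star (matM W α k l)) =
      scaleZero (Real.cos α : ℂ) fun l => star (W k l) := by
  funext l
  rw [matM, mul_add, mul_one, mul_smul_comm, Matrix.add_apply, Matrix.smul_apply, proj0, scaleZero]
  split_ifs with h
  · subst h
    have hc : star (Real.cos α : ℂ) = (Real.cos α : ℂ) := Complex.conj_ofReal _
    rw [Matrix.mul_single_apply_same, smul_eq_mul, mul_one,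
      show W k 0 + ((Real.cos α : ℂ) - 1) * W k 0 = Real.cos α * W k 0 by ring, star_mul, hc,
      mul_comm]
  · rw [Matrix.mul_single_apply_of_ne _ _ _ _ _ h, smul_zero, add_zero]

lemma matN_apply (W : Matrix (Fin d) (Fin d) ℂ) (k : Fin d) :
    (fun l => star (matN W k l)) = perp fun l => star (W k l) := by
  funext l
  rw [matN, mul_sub, mul_one, Matrix.sub_apply, proj0, perp]
  split_ifs with h
  · subst h
    simp
  · rw [Matrix.mul_single_apply_of_ne _ _ _ _ _ h, sub_zero]

/-- The prefactor `2` and the two factors `1 / 2` from the antisymmetrizers combine to the `1 / 2`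
that also relates the two-body matrix to its kernel. -/
lemma source_apply (W : Matrix (Fin d) (Fin d) ℂ) (α σ : ℝ) (R : Matrix (Fin d) (Fin d) ℂ)
    (j k : Fin d × Fin d) : source W α σ R j k =
      (1 / 2) * ((σ : ℂ) * (Real.sin α : ℂ) ^ 2 *
        (star (W k.1 0) * (W j.1 0 * (matN W * R * (matN W).conjTranspose) j.2 k.2 -
            W j.2 0 * (matN W * R * (matN W).conjTranspose) j.1 k.2) -
          star (W k.2 0) * (W j.1 0 * (matN W * R * (matN W).conjTranspose) j.2 k.1 -
            W j.2 0 * (matN W * R * (matN W).conjTranspose) j.1 k.1))) := by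
  rw [source, Matrix.smul_apply, mul_antisymProj_apply, antisymProj_mul_apply,
    antisymProj_mul_apply]
  simp only [Matrix.kroneckerMap_apply, matB_apply, Prod.fst_swap, Prod.snd_swap, smul_eq_mul]
  ring

/-- In `coupling_average_eq` the product with scaled `e₀` components is the congruence by `𝕄 ⊗ 𝕄`.
In the remainder the `e₀` coefficients of one creator and one annihilator form an entry of `𝔹`, and
the other pair gives the compressed one-body matrix; the four signed terms are the
antisymmetrization. -/
lemma twoBody_step {f g : (Fock (Fin d) →L[ℂ] Fock (Fin d)) →ₗ[ℂ] ℂ}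
    {W : Matrix (Fin d) (Fin d) ℂ} (hW : W ∈ Matrix.unitaryGroup (Fin d) ℂ) {α σ : ℝ}
    (h : ∀ A A' : Fock (Fin d) →L[ℂ] Fock (Fin d), A * secondQuant W = secondQuant W * A' →
      g A = f ((σ : ℂ) • ((numAt d + (Real.cos α : ℂ) • holeAt d) * A' *
                (numAt d + (Real.cos α : ℂ) • holeAt d) +
              (Real.sin α : ℂ) ^ 2 • (annihAt 0 * A' * createAt 0)) +
        (1 - σ : ℂ) • (((Real.cos α : ℂ) • numAt d + holeAt d) * A' *
                ((Real.cos α : ℂ) • numAt d + holeAt d) +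
              (Real.sin α : ℂ) ^ 2 • (createAt 0 * A' * annihAt 0)))) :
    twoBody g = matM2 W α * twoBody f * matM2Star W α + source W α σ (oneBody f) := by
  rw [matM2_mul_twoBody_mul, twoBody_eq]
  ext j k
  rw [Matrix.add_apply, Matrix.smul_apply, Matrix.smul_apply, source_apply, smul_eq_mul,
    smul_eq_mul, ← mul_add]
  congr 1
  -- `w k` is the vector `W* e_k`, the image of `e_k` under conjugation by `Γ(W)`.
  obtain ⟨w, hw⟩ : ∃ w : Fin d → Fin d → ℂ, w = fun k l => star (W k l) := ⟨_, rfl⟩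
  have hcomm : createAt k.1 * createAt k.2 * annihAt j.2 * annihAt j.1 * secondQuant W =
      secondQuant W * (createVec (w k.1) * createVec (w k.2) * annihVec (w j.2) *
        annihVec (w j.1)) := by
    rw [hw, mul_assoc, annihAt_mul_secondQuant hW, ← mul_assoc, mul_assoc _ _ (secondQuant W),
      annihAt_mul_secondQuant hW, ← mul_assoc, mul_assoc _ _ (secondQuant W),
      createAt_mul_secondQuant hW, ← mul_assoc, createAt_mul_secondQuant hW]
    simp only [mul_assoc]
  have hcs : (Real.sin α : ℂ) ^ 2 = 1 - (Real.cos α : ℂ) ^ 2 := by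
    rw [← Complex.ofReal_pow, Real.sin_sq]
    push_cast
    rfl
  have hc : star (Real.cos α : ℂ) = (Real.cos α : ℂ) := Complex.conj_ofReal _
  have hcar : annihAt (0 : Fin d) * createAt 0 = 1 - createAt 0 * annihAt 0 := by
    rw [annihAt_mul_createAt, if_pos rfl]
  have hZ : createVec (w k.1) * createVec (w k.2) * annihVec (w j.2) * annihVec (w j.1) =
      (w k.1 0 • createAt 0 + createVec (perp (w k.1))) *
        (w k.2 0 • createAt 0 + createVec (perp (w k.2))) *
        (star (w j.2 0) • annihAt 0 + annihVec (perp (w j.2))) *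
        (star (w j.1 0) • annihAt 0 + annihVec (perp (w j.1))) := by
    rw [← createVec_eq, ← createVec_eq, ← annihVec_eq, ← annihVec_eq]
  have hE := coupling_average_eq (annihAt_mul_self (0 : Fin d)) (createAt_mul_self 0) hcar
    (createVec_perp_mul_annihAt (w k.1)) (createVec_perp_mul_createAt (w k.1))
    (createVec_perp_mul_annihAt (w k.2)) (createVec_perp_mul_createAt (w k.2))
    (annihVec_perp_mul_annihAt (w j.2)) (annihVec_perp_mul_createAt (w j.2))
    (annihVec_perp_mul_annihAt (w j.1)) (annihVec_perp_mul_createAt (w j.1))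
    hcs (σ : ℂ) _ _ _ _ hZ
  have hG : twoBodyKernel g j k =
      g (createAt k.1 * createAt k.2 * annihAt j.2 * annihAt j.1) := rfl
  have hs : ∀ i, (Real.cos α : ℂ) * star (w i 0) = star ((Real.cos α : ℂ) * w i 0) := fun i => by
    rw [star_mul, hc, mul_comm]
  rw [hG, h _ _ hcomm, numAt, holeAt, hE, map_add, map_smul, smul_eq_mul, hs, hs,
    ← createVec_scaleZero, ← createVec_scaleZero, ← annihVec_scaleZero, ← annihVec_scaleZero]
  subst hw
  simp only [← matM_apply, ← matN_apply]
  rw [map_create_create_annih_annih]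
  simp only [sub_mul, mul_sub, smul_mul_smul_comm, map_sub, map_smul, map_create_annih,
    star_star, smul_eq_mul]
  ring

end Reduced

/-! ### The main theorem -/

/-- Discrete Duhamel formula. In the induction the term `r = 0` is the newest source and all older
ones gain a factor on each side. The truncated subtraction is harmless since `r < t` in the sum,
which is empty for `t = 0`. -/
lemma eq_pow_add_sum {R : Type*} [Ring R] {A B : R} {T S : ℕ → R}
    (h : ∀ t, T (t + 1) = A * T t * B + S t) (t : ℕ) :
    T t = A ^ t * T 0 * B ^ t + ∑ r ∈ Finset.range t, A ^ r * S (t - 1 - r) * B ^ r := by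
  induction t with
  | zero => simp
  | succ t ih =>
    rw [h, Finset.sum_range_succ', ih, mul_add, add_mul, Finset.mul_sum, Finset.sum_mul,
      pow_succ' A, pow_succ B, add_assoc]
    congr 1
    · simp only [mul_assoc]
    · congr 1
      · refine Finset.sum_congr rfl fun r _ => ?_
        rw [show t + 1 - 1 - (r + 1) = t - 1 - r by omega, pow_succ' A, pow_succ B]
        simp only [mul_assoc]
      · simp

end FermionWalk

end

theorem mainTheorem5 (d : ℕ) [NeZero d] (W : Matrix (Fin d) (Fin d) ℂ)
    (hW : W ∈ Matrix.unitaryGroup (Fin d) ℂ) (α σ : ℝ) (hσ0 : 0 ≤ σ) (hσ1 : σ ≤ 1)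
    (ω : FermionWalk.resAlg →ₗ[ℂ] ℂ)
    (hω : FermionWalk.IsQuasiFree ω
      ((σ : ℂ) • ContinuousLinearMap.id ℂ (FermionWalk.OneParticle ℤ)))
    (ρ : FermionWalk.Fock (Fin d) →L[ℂ] FermionWalk.Fock (Fin d))
    (hρ : FermionWalk.IsDensityMatrix ρ) :
    FermionWalk.twoBody (FermionWalk.sampleState ω ρ W α 0) =
        FermionWalk.twoBody (fun A => FermionWalk.fockTrace (ρ * A)) ∧
    (∀ t : ℕ, FermionWalk.twoBody (FermionWalk.sampleState ω ρ W α (t + 1)) =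
        FermionWalk.matM2 W α * FermionWalk.twoBody (FermionWalk.sampleState ω ρ W α t) *
            FermionWalk.matM2Star W α +
          FermionWalk.source W α σ
            (FermionWalk.oneBody (FermionWalk.sampleState ω ρ W α t))) ∧
    (∀ t : ℕ, 1 ≤ t → FermionWalk.twoBody (FermionWalk.sampleState ω ρ W α t) =
        FermionWalk.matM2 W α ^ t * FermionWalk.twoBody (FermionWalk.sampleState ω ρ W α 0) *
            FermionWalk.matM2Star W α ^ t +
          ∑ r ∈ Finset.range t, FermionWalk.matM2 W α ^ r *
            FermionWalk.source W α σ
              (FermionWalk.oneBody (FermionWalk.sampleState ω ρ W α (t - 1 - r))) *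
            FermionWalk.matM2Star W α ^ r) := by
  -- A merely linear extension to all bounded operators frees the computation from membership
  -- proofs; its values outside `ℬ` never matter.
  obtain ⟨F, hF'⟩ := LinearMap.exists_extend
    (p := Subalgebra.toSubmodule FermionWalk.resAlg.toSubalgebra) ω
  have hF : ∀ X : FermionWalk.resAlg, F X = ω X := fun X => LinearMap.congr_fun hF' X
  have hF1 : F 1 = 1 := (hF 1).trans hω.isState.map_one
  have hs := FermionWalk.sampleState_eq hF ρ W α
  have hstep : ∀ t : ℕ, FermionWalk.twoBody (FermionWalk.sampleState ω ρ W α (t + 1)) =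
      FermionWalk.matM2 W α * FermionWalk.twoBody (FermionWalk.sampleState ω ρ W α t) *
          FermionWalk.matM2Star W α +
        FermionWalk.source W α σ
          (FermionWalk.oneBody (FermionWalk.sampleState ω ρ W α t)) := fun t => by
    rw [hs, hs]
    exact FermionWalk.twoBody_step hW fun A A' hA =>
      FermionWalk.sampleFunctional_succ hω hF ρ hW α t hA
  refine ⟨?_, hstep, fun t _ => FermionWalk.eq_pow_add_sum
    (A := FermionWalk.matM2 W α) (B := FermionWalk.matM2Star W α)
    (T := fun t => FermionWalk.twoBody (FermionWalk.sampleState ω ρ W α t))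
    (S := fun t => FermionWalk.source W α σ
      (FermionWalk.oneBody (FermionWalk.sampleState ω ρ W α t))) hstep t⟩
  rw [hs]
  exact congrArg FermionWalk.twoBody
    (funext fun A => FermionWalk.sampleFunctional_zero hF1 ρ W α A)
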